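/- **Setting.** Let $\hat\gamma$ be a loop that is symmetric with respect to the real axis: it consists of a piecewise $C^1$ path $\gamma:[0,1]\to\overline{\mathbb C^+}$ with $\gamma(0),\gamma(1)\in\mathbb R$ and $\gamma(s)\in\mathbb C^+$ for $0<s<1$, followed by its complex conjugate run backwards (if $\gamma(0)=\gamma(1)=\mu$, the loop is pinched at $\mu$). Let $\sigma=1$ if $\hat\gamma$ is counterclockwise and $\sigma=-1$ if it is clockwise. Let $A$ be the set of non-real $\alpha\notin\hat\gamma$ around which $\hat\gamma$ has winding number $\sigma$. For $\alpha\in A$ let $R(z)=\sqrt{(z-\alpha)(z-\bar\alpha)}$, with a branch cut (band) inside the loop that joins $\bar\alpha$ to $\alpha$ and crosses $\mathbb R$ once, and $R(z)/z\to1$ at infinity; along $\hat\gamma$, $R_+$ is this radical, i.e. it is continued along $\gamma$ from the value $\sigma|\gamma(0)-\alpha|$ at $\gamma(0)$, and $R_+(\bar\zeta)=\overline{R_+(\zeta)}$. Let $f_0$ be Schwarz symmetric, $f_0(\bar z)=\overline{f_0(z)}$ for $z\notin\mathbb R$, and continuous along $\gamma$ (up to its real endpoints, with the boundary values from $\mathbb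 C^+$); $f_0$ may jump across $\mathbb R$. For real $x,t$ put $$f(z)=f_0(z)+2xz+2tz^2,\qquad h(z)=h(z;x,t,\alpha)=\frac{R(z)}{2\pi i}\oint_{\hat\gamma}\frac{f(\zeta)\,d\zeta}{(\zeta-z)R_+(\zeta)}$$ for $z$ inside the loop (in the component of $\alpha$ or of $\bar\alpha$ in its complement); $h$ is regarded as a function on the Riemann surface $\mathcal R$ of $R$, so that $R(z)$ may be either value of the root. Derivatives $\partial_\alpha,\partial_{\bar\alpha}$ are Wirtinger derivatives. The *modulation equation* is $$\oint_{\hat\gamma}\frac{f(\zeta)}{(\zeta-\alpha)R_+(\zeta)}\,d\zeta=0 .\qquad (M)$$ **Claim.** 1. For $\alpha\in A$ and real $x,t$, (M) is equivalent to its complex conjugate (the same equation with $\zeta-\bar\alpha$ in place of $\zeta-\alpha$); (M) is equivalent to the hodograph equation $x+V(\alpha,\bar\alpha)t=w(\alpha,\bar\alpha)$, and the conjugate equation to $x+\overline V t=\overline w$, where $$V=\tfrac32\alpha+\tfrac12\bar\alpha,\qquad w=-\frac{\sigma}{4\pi i}\oint_{\hat\gamma}\frac{f_0(\zeta)}{(\zeta-\alpha)R_+(\zeta)}\,d\zeta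 .$$ 2. On $A$, $V\ne\overline V$, $w$ is real-differentiable and satisfies the Tsarev equation $\dfrac{\partial_{\bar\alpha}w}{w-\overline w}=\dfrac{\partial_{\bar\alpha}V}{V-\overline V}$ and its complex conjugate (in the form with the denominators cleared, and as quotients where $w\ne\overline w$). 3. If $\alpha(x,t)\in A$ is differentiable on an open set $D\subset\mathbb R^2$ and satisfies (M) there, then it solves the genus-zero Whitham system $\alpha_t=V\alpha_x$, $\bar\alpha_t=\overline V\bar\alpha_x$ on $D$. 4. For $z$ inside the loop with $R(z)\neq0$, $$\partial_\alpha h(z)=-\frac{R(z)}{2(z-\alpha)}\cdot\frac1{2\pi i}\oint_{\hat\gamma}\frac{f(\zeta)\,d\zeta}{(\zeta-\alpha)R_+(\zeta)},$$ and likewise for $\partial_{\bar\alpha}$ with $\bar\alpha$ in place of $\alpha$. Hence $\partial_\alpha h\equiv0$ if and only if (M) holds, and $\partial_{\bar\alpha}h\equiv0$ if and only if its conjugate holds. 5. The partial derivatives at fixed $\alpha$ are $h_x=2\sigma R$ and $h_t=2\sigma(z+\operatorname{Re}\alpha)R$, and $h=xh_x+th_t+h_0$ with $h_0=\frac{R(z)}{2\pi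 i}\oint_{\hat\gamma}\frac{f_0(\zeta)d\zeta}{(\zeta-z)R_+(\zeta)}$. Along any solution $\alpha(x,t)$ of (M) as in 3, the full derivatives of $h$ in $x$ and $t$ are the same (at $R(z)\ne0$). 6. For a differentiable $\alpha(x,t)\in A$ on an open set $D$, the relation $\partial_xh_t\equiv\partial_th_x$ (for all $z$ inside the loop with $R(z)\ne0$) is equivalent to the Whitham system; so by 3 it holds for solutions of (M). 7. Let $dp$ and $dq$ be the quasimomentum and quasienergy differentials of $\mathcal R$: the meromorphic differentials whose only poles are at $\infty^\pm$, with $dp=\pm[-\zeta^{-2}+\text{holomorphic}]d\zeta$ and $dq=\pm[-2\zeta^{-3}+\text{holomorphic}]d\zeta$ there in the coordinate $\zeta=1/z$. They exist, $dp=dR$ and $dq=d\big((z+\operatorname{Re}\alpha)R\big)$, and so $dh_x=2\sigma\,dp$ and $dh_t=2\sigma\,dq$. Thus, up to the constant factor $2\sigma$, $h_x$ and $h_t$ are primitives $p,q$ of $dp,dq$, and $h$ is their potential. -/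

import Mathlib

open Set Filter Topology MeasureTheory
open scoped ComplexConjugate

noncomputable section

namespace GenusZero

/-! ### The contour and the radical -/

/-- The upper part of a loop that is symmetric with respect to the real axis: a piecewise `C¹` path
which starts and ends on the real line and stays in the open upper half-plane in between.  The loop
itself is this path followed by its mirror image run backwards.  If the two real endpoints coincide
the loop is pinched there and consists of two lobes, one in each closed half-plane. -/
structure SymmetricLoop where
  path : ℝ → ℂ
  continuousOn_path : ContinuousOn path (Icc 0 1)
  piecewise_C1 : ∃ S : Finset ℝ, ∀ s ∈ Ioo (0 : ℝ) 1, s ∉ S →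
    DifferentiableAt ℝ path s ∧ ContinuousAt (deriv path) s
  integrable_deriv : IntervalIntegrable (deriv path) volume 0 1
  start_real : (path 0).im = 0
  end_real : (path 1).im = 0
  upper : ∀ s ∈ Ioo (0 : ℝ) 1, 0 < (path s).im

/-- The set of points on the loop. -/
def SymmetricLoop.trace (γ : SymmetricLoop) : Set ℂ :=
  γ.path '' Icc 0 1 ∪ conj '' (γ.path '' Icc 0 1)

/-- `R(z)² = (z - α)(z - ᾱ)`. -/
def radicand (α z : ℂ) : ℂ := (z - α) * (z - conj α)

/-- The values `R₊` of the radical `R(ζ) = √((ζ - α)(ζ - ᾱ))` along the upper half of the loop, at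
the point `ζ = γ(s)`, for a loop of orientation `σ` (`1`: counterclockwise, `-1`: clockwise).

The branch of `R` that is analytic off a band which joins `ᾱ` to `α` and crosses the real line only
at `μ`, and that satisfies `R(z)/z → 1` at infinity, equals `|x - α|` at real `x > μ` and
`-|x - α|` at real `x < μ`.  A counterclockwise loop starts on the right of the band and a clockwise
one on its left, so that `R` has the value `σ |γ(0) - α|` at the start (in the pinched case: as its
boundary value on that side of the band).  From there it is continued along the loop; see
`rootAlong_sq`, `continuousOn_rootAlong` and `eq_rootAlong`. On the lower half of the loop
`R(ζ̄)` is the conjugate of `R(ζ)`. -/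
def rootAlong (γ : SymmetricLoop) (σ : ℤ) (α : ℂ) (s : ℝ) : ℂ :=
  (σ : ℂ) * (‖γ.path 0 - α‖ : ℂ) * Complex.exp ((1 / 2 : ℂ) *
    ∫ u in (0 : ℝ)..s, deriv γ.path u * (1 / (γ.path u - α) + 1 / (γ.path u - conj α)))

/-- The contour integral `∮ F(ζ, R(ζ)) dζ` over the whole loop: the upper half, and then the mirror
image of the upper half run backwards. -/
def loopIntegral (γ : SymmetricLoop) (σ : ℤ) (α : ℂ) (F : ℂ → ℂ → ℂ) : ℂ :=
  (∫ s in (0 : ℝ)..1, F (γ.path s) (rootAlong γ σ α s) * deriv γ.path s) -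
    ∫ s in (0 : ℝ)..1,
      F (conj (γ.path s)) (conj (rootAlong γ σ α s)) * conj (deriv γ.path s)

/-- The branch points `α` around which the loop goes once, with orientation `σ`. -/
def encircled (γ : SymmetricLoop) (σ : ℤ) : Set ℂ :=
  {α | α.im ≠ 0 ∧ α ∉ γ.trace ∧
    loopIntegral γ σ α (fun ζ _ => 1 / (ζ - α)) = 2 * Real.pi * Complex.I * (σ : ℂ)}

/-- The points inside the loop: the components of `α` and of `ᾱ` in the complement of the loop. -/
def inside (γ : SymmetricLoop) (α : ℂ) : Set ℂ :=
  connectedComponentIn (γ.trace)ᶜ α ∪ connectedComponentIn (γ.trace)ᶜ (conj α)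

/-- The square root of `w` that continues the square root `r ≠ 0` of `r ^ 2` to `w` near `r ^ 2`. -/
def sqrtNear (r w : ℂ) : ℂ := r * (w / r ^ 2) ^ (1 / 2 : ℂ)

/-! ### The function `f`, the modulation equation and `h` -/

/-- `f(ζ) = f₀(ζ) + 2 x ζ + 2 t ζ²`. -/
def phase (f₀ : ℂ → ℂ) (x t : ℝ) (ζ : ℂ) : ℂ := f₀ ζ + 2 * ζ * x + 2 * t * ζ ^ 2

/-- `∮ f(ζ) / ((ζ - z) R(ζ)) dζ`. -/
def cauchy (γ : SymmetricLoop) (σ : ℤ) (α : ℂ) (f : ℂ → ℂ) (z : ℂ) : ℂ :=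
  loopIntegral γ σ α (fun ζ R => f ζ / ((ζ - z) * R))

/-- The modulation equation `∮ f(ζ) / ((ζ - α) R(ζ)) dζ = 0`. -/
def ModulationEq (γ : SymmetricLoop) (σ : ℤ) (f₀ : ℂ → ℂ) (x t : ℝ) (α : ℂ) : Prop :=
  cauchy γ σ α (phase f₀ x t) α = 0

/-- Its complex conjugate, `∮ f(ζ) / ((ζ - ᾱ) R(ζ)) dζ = 0`. -/
def ModulationEqConj (γ : SymmetricLoop) (σ : ℤ) (f₀ : ℂ → ℂ) (x t : ℝ) (α : ℂ) : Prop :=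
  cauchy γ σ α (phase f₀ x t) (conj α) = 0

/-- `h = R(z)/(2πi) ∮ f(ζ) / ((ζ - z) R(ζ)) dζ` at the point `(z, r)` of the Riemann surface
`r² = (z - α)(z - ᾱ)`; on the main sheet `r = R(z)`. -/
def h (γ : SymmetricLoop) (σ : ℤ) (f₀ : ℂ → ℂ) (z r : ℂ) (x t : ℝ) (α : ℂ) : ℂ :=
  r / (2 * Real.pi * Complex.I) * cauchy γ σ α (phase f₀ x t) z

/-- The part `h₀` of `h` that comes from `f₀`. -/
def h₀ (γ : SymmetricLoop) (σ : ℤ) (f₀ : ℂ → ℂ) (z r α : ℂ) : ℂ :=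
  r / (2 * Real.pi * Complex.I) * cauchy γ σ α f₀ z

/-- The partial derivative `h_x` (with `z`, `t` and `α` fixed). -/
def hx (γ : SymmetricLoop) (σ : ℤ) (f₀ : ℂ → ℂ) (z r : ℂ) (x t : ℝ) (α : ℂ) : ℂ :=
  deriv (fun x' : ℝ => h γ σ f₀ z r x' t α) x

/-- The partial derivative `h_t` (with `z`, `x` and `α` fixed). -/
def ht (γ : SymmetricLoop) (σ : ℤ) (f₀ : ℂ → ℂ) (z r : ℂ) (x t : ℝ) (α : ℂ) : ℂ :=
  deriv (fun t' : ℝ => h γ σ f₀ z r x t' α) t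

/-! ### The genus zero Whitham system, the hodograph and Tsarev equations -/

/-- `∂/∂α = (∂/∂(Re α) - i ∂/∂(Im α)) / 2`. -/
def wirtinger (g : ℂ → ℂ) (α : ℂ) : ℂ :=
  (fderiv ℝ g α 1 - Complex.I * fderiv ℝ g α Complex.I) / 2

/-- `∂/∂ᾱ = (∂/∂(Re α) + i ∂/∂(Im α)) / 2`. -/
def wirtingerBar (g : ℂ → ℂ) (α : ℂ) : ℂ :=
  (fderiv ℝ g α 1 + Complex.I * fderiv ℝ g α Complex.I) / 2

/-- The characteristic velocity `V = 3/2 α + 1/2 ᾱ`. -/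
def V (α : ℂ) : ℂ := 3 / 2 * α + 1 / 2 * conj α

/-- `w = -σ/(4πi) ∮ f₀(ζ) / ((ζ - α) R(ζ)) dζ`. -/
def w (γ : SymmetricLoop) (σ : ℤ) (f₀ : ℂ → ℂ) (α : ℂ) : ℂ :=
  -(σ : ℂ) / (4 * Real.pi * Complex.I) * cauchy γ σ α f₀ α

/-- The genus zero Tsarev equation `∂_ᾱ w / (w - w̄) = ∂_ᾱ V / (V - V̄)` and its complex conjugate,
at `α`.  The first two equations are the denominator-free form, the other two the quotients. -/
def IsTsarevAt (V w : ℂ → ℂ) (α : ℂ) : Prop :=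
  DifferentiableAt ℝ V α ∧ DifferentiableAt ℝ w α ∧ V α ≠ conj (V α) ∧
  wirtingerBar w α * (V α - conj (V α)) = wirtingerBar V α * (w α - conj (w α)) ∧
  wirtinger (fun a => conj (w a)) α * (conj (V α) - V α) =
    wirtinger (fun a => conj (V a)) α * (conj (w α) - w α) ∧
  (w α ≠ conj (w α) →
    wirtingerBar w α / (w α - conj (w α)) = wirtingerBar V α / (V α - conj (V α)) ∧
    wirtinger (fun a => conj (w a)) α / (conj (w α) - w α) =
      wirtinger (fun a => conj (V a)) α / (conj (V α) - V α))

/-- `α_t = V α_x` and `ᾱ_t = V̄ ᾱ_x` on `D`, for `α` a function of `(x, t)`. -/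
def SolvesWhitham (D : Set (ℝ × ℝ)) (α : ℝ × ℝ → ℂ) : Prop :=
  ∀ p ∈ D,
    fderiv ℝ α p (0, 1) = V (α p) * fderiv ℝ α p (1, 0) ∧
    fderiv ℝ (fun q => conj (α q)) p (0, 1) =
      conj (V (α p)) * fderiv ℝ (fun q => conj (α q)) p (1, 0)

/-! ### Quasimomentum and quasienergy on the genus zero Riemann surface -/

/-- The finite part of the Riemann surface `r² = (z - α)(z - ᾱ)`. -/
def curve (α : ℂ) : Set (ℂ × ℂ) := {P | P.2 ^ 2 = radicand α P.1}

/-- Differentials on the surface are written as `F(z, r) dz / r`; for `α ≠ ᾱ` the differential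
`dz / r` has neither zeros nor poles on the finite part.  So `F dz / r` is holomorphic there if and
only if `F` is locally the restriction to the curve of a holomorphic function of `(z, r)`. -/
def HolomorphicOnCurve (α : ℂ) (F : ℂ × ℂ → ℂ) : Prop :=
  ∀ P ∈ curve α, ∃ G : ℂ × ℂ → ℂ, AnalyticAt ℂ G P ∧ F =ᶠ[𝓝[curve α] P] G

/-- In the local coordinate `ζ = 1/z`, the differential `F dz / r` is `±(k(ζ) + holomorphic) dζ`
near `∞±`, where `∞±` is the point at which `r / z → ±1`. Here `dz = -dζ / ζ²`. -/
def PrincipalPartAtInfinity (α : ℂ) (F : ℂ × ℂ → ℂ) (k : ℂ → ℂ) : Prop :=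
  ∀ ε : ℂ, ε = 1 ∨ ε = -1 →
    ∃ H : ℂ → ℂ, AnalyticAt ℂ H 0 ∧
      ∀ᶠ ζ in 𝓝[≠] (0 : ℂ), ∀ r : ℂ, (ζ⁻¹, r) ∈ curve α → ‖r * ζ - ε‖ < 1 →
        F (ζ⁻¹, r) / r * (-1 / ζ ^ 2) = ε * (k ζ + H ζ)

/-- `F dz / r` is the quasimomentum differential `dp`: it is holomorphic but for the double poles
`dp ~ ±(-1/ζ² + holomorphic) dζ` at `∞±`.  In genus zero there is no normalization over cycles. -/
def IsQuasimomentum (α : ℂ) (F : ℂ × ℂ → ℂ) : Prop :=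
  HolomorphicOnCurve α F ∧ PrincipalPartAtInfinity α F (fun ζ => -1 / ζ ^ 2)

/-- `F dz / r` is the quasienergy differential `dq`: it is holomorphic but for the triple poles
`dq ~ ±(-2/ζ³ + holomorphic) dζ` at `∞±`. -/
def IsQuasienergy (α : ℂ) (F : ℂ × ℂ → ℂ) : Prop :=
  HolomorphicOnCurve α F ∧ PrincipalPartAtInfinity α F (fun ζ => -2 / ζ ^ 3)

/-! ### `rootAlong` is the square root of `(ζ - α)(ζ - ᾱ)` continued along the loop -/

theorem path_sub_ne {γ : SymmetricLoop} {α : ℂ} (hα : α ∉ γ.trace) {s : ℝ} (hs : s ∈ Icc (0 : ℝ) 1) :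
    γ.path s - α ≠ 0 ∧ γ.path s - conj α ≠ 0 := by
  constructor
  · intro h0
    exact hα (Or.inl ⟨s, hs, sub_eq_zero.mp h0⟩)
  · intro h0
    refine hα (Or.inr ⟨γ.path s, ⟨s, hs, rfl⟩, ?_⟩)
    rw [sub_eq_zero.mp h0, Complex.conj_conj]

theorem continuousOn_kernel {γ : SymmetricLoop} {α : ℂ} (hα : α ∉ γ.trace) :
    ContinuousOn (fun u => 1 / (γ.path u - α) + 1 / (γ.path u - conj α)) (Icc 0 1) := by
  refine ContinuousOn.add ?_ ?_
  · exact continuousOn_const.div (γ.continuousOn_path.sub continuousOn_const)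
      fun s hs => (path_sub_ne hα hs).1
  · exact continuousOn_const.div (γ.continuousOn_path.sub continuousOn_const)
      fun s hs => (path_sub_ne hα hs).2

theorem integrable_kernel {γ : SymmetricLoop} {α : ℂ} (hα : α ∉ γ.trace) :
    IntervalIntegrable (fun u => deriv γ.path u *
      (1 / (γ.path u - α) + 1 / (γ.path u - conj α))) volume 0 1 := by
  refine γ.integrable_deriv.mul_continuousOn ?_
  rw [uIcc_of_le zero_le_one]
  exact continuousOn_kernel hα

theorem continuousOn_rootAlong {γ : SymmetricLoop} (σ : ℤ) {α : ℂ} (hα : α ∉ γ.trace) :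
    ContinuousOn (rootAlong γ σ α) (Icc 0 1) := by
  have h1 := intervalIntegral.continuousOn_primitive_interval'
    (integrable_kernel hα) (left_mem_uIcc)
  rw [uIcc_of_le zero_le_one] at h1
  exact continuousOn_const.mul (Complex.continuous_exp.comp_continuousOn (continuousOn_const.mul h1))

theorem rootAlong_sq {γ : SymmetricLoop} {σ : ℤ} (hσ : σ = 1 ∨ σ = -1) {α : ℂ} (hα : α ∉ γ.trace)
    {s : ℝ} (hs : s ∈ Icc (0 : ℝ) 1) :
    rootAlong γ σ α s ^ 2 = radicand α (γ.path s) := by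
  obtain ⟨S, hS⟩ := γ.piecewise_C1
  set k : ℝ → ℂ := fun u => deriv γ.path u *
    (1 / (γ.path u - α) + 1 / (γ.path u - conj α)) with hk
  set E : ℝ → ℂ := fun s => ∫ u in (0 : ℝ)..s, k u with hE
  have hEc : ContinuousOn E (Icc 0 1) := by
    have h1 := intervalIntegral.continuousOn_primitive_interval'
      (integrable_kernel hα) (left_mem_uIcc)
    rwa [uIcc_of_le zero_le_one] at h1
  set G : ℝ → ℂ := fun s => radicand α (γ.path s) * Complex.exp (-E s) with hG
  have hGc : ContinuousOn G (Icc 0 1) := by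
    refine ContinuousOn.mul ?_ (Complex.continuous_exp.comp_continuousOn hEc.neg)
    exact (γ.continuousOn_path.sub continuousOn_const).mul
      (γ.continuousOn_path.sub continuousOn_const)
  have hGd : ∀ u ∈ Ioo (0 : ℝ) 1 \ (S : Set ℝ), HasDerivAt G 0 u := by
    rintro u ⟨hu, huS⟩
    obtain ⟨hd, hc⟩ := hS u hu huS
    have hu' : u ∈ Icc (0 : ℝ) 1 := Ioo_subset_Icc_self hu
    obtain ⟨n1, n2⟩ := path_sub_ne hα hu'
    have hkc : ContinuousAt k u := by
      refine hc.mul ?_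
      exact (continuousOn_kernel hα).continuousAt (Icc_mem_nhds hu.1 hu.2)
    have hki : IntervalIntegrable k volume 0 u :=
      (integrable_kernel hα).mono_set (by
        rw [uIcc_of_le hu'.1, uIcc_of_le zero_le_one]; exact Icc_subset_Icc le_rfl hu'.2)
    have hmeas : StronglyMeasurableAtFilter k (𝓝 u) volume := by
      refine ⟨Ioc 0 1, mem_of_superset (Ioo_mem_nhds hu.1 hu.2) Ioo_subset_Ioc_self, ?_⟩
      have := (integrable_kernel hα).1
      exact this.aestronglyMeasurable
    have hEd : HasDerivAt E (k u) u := intervalIntegral.integral_hasDerivAt_right hki hmeas hkc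
    have hp := hd.hasDerivAt
    have h3 := ((hp.sub_const α).mul (hp.sub_const (conj α))).mul hEd.neg.cexp
    have hval : (deriv γ.path u * (γ.path u - conj α) + (γ.path u - α) * deriv γ.path u) *
        Complex.exp ((-E) u) + (γ.path u - α) * (γ.path u - conj α) *
          (Complex.exp ((-E) u) * -k u) = 0 := by
      simp only [hk]
      field_simp
      ring
    exact h3.congr_deriv hval
  have hconst : G s = G 0 := by
    have h4 := MeasureTheory.integral_eq_of_hasDerivAt_off_countable_of_le
      G (fun _ => 0) hs.1 (S.countable_toSet)
      (hGc.mono (Icc_subset_Icc le_rfl hs.2))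
      (fun u hu => hGd u ⟨⟨hu.1.1, hu.1.2.trans_le hs.2⟩, hu.2⟩)
      (by simp)
    simp only [intervalIntegral.integral_zero] at h4
    exact (sub_eq_zero.mp h4.symm)
  have hσ2 : ((σ : ℂ)) ^ 2 = 1 := by
    rcases hσ with rfl | rfl <;> norm_num
  have hG0 : G 0 = (‖γ.path 0 - α‖ : ℂ) ^ 2 := by
    have hreal : conj (γ.path 0) = γ.path 0 := Complex.conj_eq_iff_im.mpr γ.start_real
    have h5 : γ.path 0 - conj α = conj (γ.path 0 - α) := by rw [map_sub, hreal]
    simp only [hG, hE, radicand, intervalIntegral.integral_same, neg_zero, Complex.exp_zero, mul_one,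
      h5]
    rw [Complex.mul_conj']
  have hexp : Complex.exp ((1 / 2 : ℂ) * E s) ^ 2 = Complex.exp (E s) := by
    rw [← Complex.exp_nat_mul]
    congr 1
    push_cast
    ring
  have hmain : rootAlong γ σ α s ^ 2 = (‖γ.path 0 - α‖ : ℂ) ^ 2 * Complex.exp (E s) := by
    change ((σ : ℂ) * (‖γ.path 0 - α‖ : ℂ) * Complex.exp ((1 / 2 : ℂ) * E s)) ^ 2 = _
    rw [mul_pow, mul_pow, hσ2, hexp, one_mul]
  rw [hmain, ← hG0, ← hconst]
  simp only [hG]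
  rw [mul_assoc, ← Complex.exp_add, neg_add_cancel, Complex.exp_zero, mul_one]

/-- Any function that is a continuous square root of `(ζ - α)(ζ - ᾱ)` along the upper half of the
loop and has the limit `σ |γ(0) - α|` at its start is `rootAlong`. -/
theorem eq_rootAlong {γ : SymmetricLoop} {σ : ℤ} (hσ : σ = 1 ∨ σ = -1) {α : ℂ} (hα : α ∉ γ.trace)
    {ρ : ℝ → ℂ} (hc : ContinuousOn ρ (Ioo 0 1))
    (hsq : ∀ s ∈ Ioo (0 : ℝ) 1, ρ s ^ 2 = radicand α (γ.path s))
    (h0 : Tendsto ρ (𝓝[>] 0) (𝓝 ((σ : ℂ) * (‖γ.path 0 - α‖ : ℂ)))) :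
    ∀ s ∈ Ioo (0 : ℝ) 1, ρ s = rootAlong γ σ α s := by
  have hR := continuousOn_rootAlong (γ := γ) σ hα
  have hne : ∀ s ∈ Ioo (0 : ℝ) 1, rootAlong γ σ α s ≠ 0 := by
    intro s hs h
    have h2 := rootAlong_sq hσ hα (Ioo_subset_Icc_self hs)
    obtain ⟨n1, n2⟩ := path_sub_ne hα (Ioo_subset_Icc_self hs)
    rw [h] at h2
    exact mul_ne_zero n1 n2 (by simpa [radicand] using h2.symm)
  have key := isPreconnected_Ioo.eq_or_eq_neg_of_sq_eq hc (hR.mono Ioo_subset_Icc_self)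
    (fun s hs => by
      simpa using (hsq s hs).trans (rootAlong_sq hσ hα (Ioo_subset_Icc_self hs)).symm)
    (fun {s} hs => hne s hs)
  rcases key with h | h
  · exact h
  · exfalso
    have hv : rootAlong γ σ α 0 = (σ : ℂ) * (‖γ.path 0 - α‖ : ℂ) := by simp [rootAlong]
    have h1 : Tendsto (rootAlong γ σ α) (𝓝[>] 0) (𝓝 ((σ : ℂ) * (‖γ.path 0 - α‖ : ℂ))) := by
      rw [← hv]
      exact (hR 0 (by simp)).mono_left (nhdsWithin_le_of_mem
        (mem_of_superset (Ioo_mem_nhdsGT zero_lt_one) Ioo_subset_Icc_self))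
    have h2 : Tendsto ρ (𝓝[>] 0) (𝓝 (-((σ : ℂ) * (‖γ.path 0 - α‖ : ℂ)))) := by
      refine h1.neg.congr' ?_
      filter_upwards [Ioo_mem_nhdsGT (zero_lt_one (α := ℝ))] with s hs
      exact (h hs).symm
    have h3 := tendsto_nhds_unique h0 h2
    have h4 : (σ : ℂ) * (‖γ.path 0 - α‖ : ℂ) ≠ 0 := by
      refine mul_ne_zero (by rcases hσ with rfl | rfl <;> norm_num) ?_
      have := (path_sub_ne hα (s := 0) (by simp)).1
      simpa using this
    exact h4 (self_eq_neg.mp h3)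

end GenusZero

end

open GenusZero

noncomputable section

namespace GenusZero

/-! ### Points of the loop -/

/-! No contour is deformed and no residue is taken: `f₀` is only continuous along the upper half, so
everything rests on primitives along that half and on Schwarz symmetry. By symmetry a loop integral
against `dζ / R` is an upper integral minus the conjugate of an upper integral. The winding
condition enters through `rootAlong_one`: `R₊` is real at both real ends and has opposite signs
there. So boundary terms that are real rational expressions in `R₊` cancel against their conjugates,
and only a logarithm survives.

Write `Q` for the radicand and `C(z) = ∮ f / ((ζ - z) R)`. The primitive `R` gives `∮ (ζ - Re α) / R
= 0`, and `log (ζ - Re α + R)` gives `∮ 1 / R = 2πiσ`. The primitive `-R / (ζ - z)` gives, for `f =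
1`, the equation `Q C' + Q' C / 2 = 0`. Hence `Q C²` is locally constant; it vanishes at `α` and
`ᾱ`, so `C = 0` inside the loop (`cauchy_one_eq_zero`). The integrals for `f = ζ` and `f = ζ²`
follow, which makes `h` explicitly affine in `x` and `t` and turns the modulation equation into the
hodograph equation.

For the dependence on `α`, `R₊` at a nearby branch point is the old `R₊` times principal square
roots of ratios close to `1`, so differentiation under the integral is legitimate and `∂_α (1/R) = 1
/ (2 (ζ - α) R)`. Partial fractions then do the rest. In `∂_α h` the terms with `C(z)` cancel and
`C(α)` remains (`hasFDerivAt_h`). In `∂_ᾱ w` the values `C(α)` and `C(ᾱ) = -conj C(α)` combine to `w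
- w̄` (`hasFDerivAt_w`), which is the Tsarev equation. On the hodograph this gives `w_ᾱ = t V_ᾱ`, so
the `ᾱ` terms drop out on differentiation and the Whitham system is left.

The curve is rational. The difference of two differentials with the same principal parts becomes an
entire function of the parameter that tends to `0` at infinity, so Liouville's theorem gives
uniqueness and `dp`, `dq` are the explicit ones. -/

theorem SymmetricLoop.isCompact_trace (γ : SymmetricLoop) : IsCompact γ.trace := by
  have h := isCompact_Icc.image_of_continuousOn γ.continuousOn_path
  exact h.union (h.image Complex.continuous_conj)

theorem SymmetricLoop.isOpen_compl_trace (γ : SymmetricLoop) : IsOpen γ.traceᶜ :=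
  γ.isCompact_trace.isClosed.isOpen_compl

theorem SymmetricLoop.path_mem (γ : SymmetricLoop) {s : ℝ} (hs : s ∈ Icc (0 : ℝ) 1) :
    γ.path s ∈ γ.trace := Or.inl ⟨s, hs, rfl⟩

theorem SymmetricLoop.conj_path_mem (γ : SymmetricLoop) {s : ℝ} (hs : s ∈ Icc (0 : ℝ) 1) :
    conj (γ.path s) ∈ γ.trace := Or.inr ⟨_, ⟨s, hs, rfl⟩, rfl⟩

theorem SymmetricLoop.conj_mem_trace {γ : SymmetricLoop} {z : ℂ} (hz : z ∈ γ.trace) :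
    conj z ∈ γ.trace := by
  rcases hz with ⟨s, hs, rfl⟩ | ⟨_, ⟨s, hs, rfl⟩, rfl⟩
  · exact γ.conj_path_mem hs
  · simpa using γ.path_mem hs

theorem SymmetricLoop.conj_notMem_trace {γ : SymmetricLoop} {z : ℂ} (hz : z ∉ γ.trace) :
    conj z ∉ γ.trace := fun h => hz (by simpa using SymmetricLoop.conj_mem_trace h)

theorem sub_ne_of_mem_of_notMem {S : Set ℂ} {ζ z : ℂ} (hζ : ζ ∈ S) (hz : z ∉ S) : ζ - z ≠ 0 :=
  fun h => hz (sub_eq_zero.mp h ▸ hζ)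

theorem sub_conj_eq {α : ℂ} : α - conj α = 2 * Complex.I * α.im := by
  apply Complex.ext <;> simp; ring

theorem sub_conj_ne_zero {α : ℂ} (h : α.im ≠ 0) : α - conj α ≠ 0 := by
  rw [sub_conj_eq]; simp [h]

theorem radicand_eq (α z : ℂ) : radicand α z = (z - α.re) ^ 2 + (α.im : ℂ) ^ 2 := by
  rw [radicand]
  have h1 : conj α = α.re - α.im * Complex.I := by
    apply Complex.ext <;> simp
  rw [h1]
  nth_rewrite 1 [← Complex.re_add_im α]
  linear_combination (-(α.im : ℂ) ^ 2) * Complex.I_sq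

theorem radicand_conj (α z : ℂ) : radicand α (conj z) = conj (radicand α z) := by
  simp [radicand, mul_comm]

theorem add_conj_eq (α : ℂ) : α + conj α = 2 * α.re := by
  apply Complex.ext <;> simp; ring

theorem radicand_ne_zero {α z : ℂ} (h1 : z - α ≠ 0) (h2 : z - conj α ≠ 0) : radicand α z ≠ 0 :=
  mul_ne_zero h1 h2

/-! ### The radical along the loop -/

theorem rootAlong_ne_zero {γ : SymmetricLoop} {σ : ℤ} (hσ : σ = 1 ∨ σ = -1) {α : ℂ}
    (hα : α ∉ γ.trace) {s : ℝ} (hs : s ∈ Icc (0 : ℝ) 1) : rootAlong γ σ α s ≠ 0 := by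
  intro h
  have h2 := rootAlong_sq hσ hα hs
  obtain ⟨n1, n2⟩ := path_sub_ne hα hs
  rw [h] at h2
  exact mul_ne_zero n1 n2 (by simpa [radicand] using h2.symm)

theorem rootAlong_zero (γ : SymmetricLoop) (σ : ℤ) (α : ℂ) :
    rootAlong γ σ α 0 = ((σ * ‖γ.path 0 - α‖ : ℝ) : ℂ) := by
  simp [rootAlong]

theorem integral_conj_interval (f : ℝ → ℂ) (a b : ℝ) :
    ∫ s in a..b, conj (f s) = conj (∫ s in a..b, f s) := by
  simp only [intervalIntegral, integral_conj, map_sub]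

/-- The winding integral is `I₁ - conj I₂`, where `I₁ + I₂` is the exponent integral in `rootAlong`.
Both have the same imaginary part `2πσ`, so half of it turns `R₊` by `πσ` and flips its sign. -/
theorem rootAlong_one {γ : SymmetricLoop} {σ : ℤ} (hσ : σ = 1 ∨ σ = -1) {α : ℂ}
    (hα : α ∈ encircled γ σ) :
    ∃ ρ : ℝ, 0 < ρ ∧ rootAlong γ σ α 1 = ((-σ * ρ : ℝ) : ℂ) := by
  obtain ⟨_, hα, hw⟩ := hα
  have hi : ∀ z ∉ γ.trace, IntervalIntegrable (fun s => deriv γ.path s * (1 / (γ.path s - z)))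
      volume 0 1 := by
    intro z hz
    refine γ.integrable_deriv.mul_continuousOn ?_
    rw [uIcc_of_le zero_le_one]
    exact continuousOn_const.div (γ.continuousOn_path.sub continuousOn_const)
      fun s hs => sub_ne_of_mem_of_notMem (γ.path_mem hs) hz
  have hE : ∫ u in (0 : ℝ)..1, deriv γ.path u * (1 / (γ.path u - α) + 1 / (γ.path u - conj α)) =
      (∫ u in (0 : ℝ)..1, deriv γ.path u * (1 / (γ.path u - α))) +
        ∫ u in (0 : ℝ)..1, deriv γ.path u * (1 / (γ.path u - conj α)) := by
    rw [← intervalIntegral.integral_add (hi _ hα) (hi _ (SymmetricLoop.conj_notMem_trace hα))]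
    simp only [mul_add]
  set I₁ := ∫ u in (0 : ℝ)..1, deriv γ.path u * (1 / (γ.path u - α)) with hI₁
  set I₂ := ∫ u in (0 : ℝ)..1, deriv γ.path u * (1 / (γ.path u - conj α)) with hI₂
  have hW : I₁ - conj I₂ = 2 * Real.pi * Complex.I * (σ : ℂ) := by
    rw [← hw, loopIntegral, hI₁, hI₂, ← integral_conj_interval]
    congr 2
    · ext s; ring
    · ext s; simp [mul_comm]
  have him : (I₁ + I₂).im = 2 * Real.pi * σ := by
    have := congrArg Complex.im hW
    simpa using this
  refine ⟨‖γ.path 0 - α‖ * Real.exp ((I₁ + I₂).re / 2),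
    mul_pos (norm_pos_iff.mpr (path_sub_ne hα (by simp)).1) (Real.exp_pos _), ?_⟩
  rw [rootAlong, hE]
  have h2 : (1 / 2 : ℂ) * (I₁ + I₂) = (((I₁ + I₂).re / 2 : ℝ) : ℂ) + σ * (Real.pi * Complex.I) := by
    apply Complex.ext
    · simp; ring
    · simp at him ⊢
      rw [him]; ring
  rw [h2, Complex.exp_add]
  have h3 : Complex.exp (σ * (Real.pi * Complex.I)) = -1 := by
    rcases hσ with rfl | rfl
    · simp
    · simp [Complex.exp_neg]
  rw [h3]
  push_cast
  ring

theorem rootAlong_one_real {γ : SymmetricLoop} {σ : ℤ} (hσ : σ = 1 ∨ σ = -1) {α : ℂ}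
    (hα : α ∈ encircled γ σ) : conj (rootAlong γ σ α 1) = rootAlong γ σ α 1 := by
  obtain ⟨ρ, _, h⟩ := rootAlong_one hσ hα
  rw [h, Complex.conj_ofReal]

theorem rootAlong_zero_real (γ : SymmetricLoop) (σ : ℤ) (α : ℂ) :
    conj (rootAlong γ σ α 0) = rootAlong γ σ α 0 := by
  rw [rootAlong_zero, Complex.conj_ofReal]

theorem hasDerivAt_rootAlong {γ : SymmetricLoop} {σ : ℤ} (hσ : σ = 1 ∨ σ = -1) {α : ℂ}
    (hα : α ∉ γ.trace) {s : ℝ} (hs : s ∈ Ioo (0 : ℝ) 1) (hc : ContinuousAt (deriv γ.path) s) :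
    HasDerivAt (rootAlong γ σ α)
      ((γ.path s - α.re) / rootAlong γ σ α s * deriv γ.path s) s := by
  have hs' := Ioo_subset_Icc_self hs
  obtain ⟨n1, n2⟩ := path_sub_ne hα hs'
  have hR := rootAlong_ne_zero hσ hα hs'
  have hi := integrable_kernel hα
  have hki := hi.mono_set (c := 0) (d := s) (by
    rw [uIcc_of_le hs'.1, uIcc_of_le zero_le_one]; exact Icc_subset_Icc le_rfl hs'.2)
  have hmeas : StronglyMeasurableAtFilter (fun u => deriv γ.path u *
      (1 / (γ.path u - α) + 1 / (γ.path u - conj α))) (𝓝 s) volume :=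
    ⟨Ioc 0 1, mem_of_superset (Ioo_mem_nhds hs.1 hs.2) Ioo_subset_Ioc_self,
      hi.1.aestronglyMeasurable⟩
  have hkc := hc.mul ((continuousOn_kernel hα).continuousAt (Icc_mem_nhds hs.1 hs.2))
  have hd := (((intervalIntegral.integral_hasDerivAt_right hki hmeas hkc).const_mul
    (1 / 2 : ℂ)).cexp).const_mul ((σ : ℂ) * (‖γ.path 0 - α‖ : ℂ))
  refine hd.congr_deriv ?_
  rw [← mul_assoc]
  change rootAlong γ σ α s * _ = _
  have hsq := rootAlong_sq hσ hα hs'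
  rw [radicand] at hsq
  have hre : (α.re : ℂ) = (α + conj α) / 2 := by rw [add_conj_eq]; ring
  rw [hre]
  field_simp
  rw [hsq]
  ring

/-- The fundamental theorem of calculus along the upper half of the loop. -/
theorem integral_eq_sub_along (γ : SymmetricLoop) {G g : ℝ → ℂ} (hG : ContinuousOn G (Icc 0 1))
    (hd : ∀ s ∈ Ioo (0 : ℝ) 1, DifferentiableAt ℝ γ.path s → ContinuousAt (deriv γ.path) s →
      HasDerivAt G (g s * deriv γ.path s) s) (hg : ContinuousOn g (Icc 0 1)) :
    ∫ s in (0 : ℝ)..1, g s * deriv γ.path s = G 1 - G 0 := by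
  obtain ⟨S, hS⟩ := γ.piecewise_C1
  refine MeasureTheory.integral_eq_of_hasDerivAt_off_countable_of_le G _ zero_le_one
    S.countable_toSet hG (fun s hs => ?_) ?_
  · obtain ⟨h1, h2⟩ := hS s hs.1 hs.2
    exact hd s hs.1 h1 h2
  · refine γ.integrable_deriv.continuousOn_mul ?_
    rwa [uIcc_of_le zero_le_one]

/-! ### Integrals against `dζ / R` -/

/-- `∮ g(ζ) dζ / R(ζ)`. -/
def radIntegral (γ : SymmetricLoop) (σ : ℤ) (α : ℂ) (g : ℂ → ℂ) : ℂ :=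
  loopIntegral γ σ α (fun ζ R => g ζ / R)

/-- Integrability of `g(ζ) dζ / R(ζ)` along the loop. -/
def RadIntegrable (γ : SymmetricLoop) (σ : ℤ) (α : ℂ) (g : ℂ → ℂ) : Prop :=
  IntervalIntegrable (fun s => g (γ.path s) / rootAlong γ σ α s * deriv γ.path s) volume 0 1 ∧
  IntervalIntegrable (fun s => g (conj (γ.path s)) / conj (rootAlong γ σ α s) *
    conj (deriv γ.path s)) volume 0 1

/-- Schwarz symmetric functions that are continuous along the upper half of the loop. -/
structure SymmetricLoop.IsSchwarz (γ : SymmetricLoop) (f : ℂ → ℂ) : Prop where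
  map_conj : ∀ z : ℂ, z.im ≠ 0 → f (conj z) = conj (f z)
  continuousOn : ContinuousOn (fun s => f (γ.path s)) (Icc 0 1)

theorem cauchy_eq_radIntegral (γ : SymmetricLoop) (σ : ℤ) (α : ℂ) (f : ℂ → ℂ) (z : ℂ) :
    cauchy γ σ α f z = radIntegral γ σ α (fun ζ => f ζ * (1 / (ζ - z))) := by
  rw [cauchy, radIntegral]
  congr 1
  ext ζ R
  rw [div_eq_mul_inv, mul_inv]
  ring

theorem RadIntegrable.add {γ : SymmetricLoop} {σ : ℤ} {α : ℂ} {g k : ℂ → ℂ}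
    (hg : RadIntegrable γ σ α g) (hk : RadIntegrable γ σ α k) :
    RadIntegrable γ σ α (fun ζ => g ζ + k ζ) := by
  refine ⟨(hg.1.add hk.1).congr fun s _ => ?_, (hg.2.add hk.2).congr fun s _ => ?_⟩ <;>
  · ring

theorem RadIntegrable.const_mul {γ : SymmetricLoop} {σ : ℤ} {α : ℂ} {g : ℂ → ℂ}
    (hg : RadIntegrable γ σ α g) (c : ℂ) : RadIntegrable γ σ α (fun ζ => c * g ζ) := by
  refine ⟨(hg.1.const_mul c).congr fun s _ => ?_, (hg.2.const_mul c).congr fun s _ => ?_⟩ <;> ring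

theorem radIntegral_add {γ : SymmetricLoop} {σ : ℤ} {α : ℂ} {g k : ℂ → ℂ}
    (hg : RadIntegrable γ σ α g) (hk : RadIntegrable γ σ α k) :
    radIntegral γ σ α (fun ζ => g ζ + k ζ) = radIntegral γ σ α g + radIntegral γ σ α k := by
  simp only [radIntegral, loopIntegral, add_div, add_mul]
  rw [intervalIntegral.integral_add hg.1 hk.1, intervalIntegral.integral_add hg.2 hk.2]
  ring

theorem radIntegral_const_mul (γ : SymmetricLoop) (σ : ℤ) (α c : ℂ) (g : ℂ → ℂ) :
    radIntegral γ σ α (fun ζ => c * g ζ) = c * radIntegral γ σ α g := by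
  simp only [radIntegral, loopIntegral, mul_div_assoc, mul_assoc,
    intervalIntegral.integral_const_mul]
  ring

theorem radIntegral_congr {γ : SymmetricLoop} {σ : ℤ} {α : ℂ} {g k : ℂ → ℂ}
    (h : ∀ ζ ∈ γ.trace, g ζ = k ζ) : radIntegral γ σ α g = radIntegral γ σ α k := by
  simp only [radIntegral, loopIntegral]
  congr 1 <;> refine intervalIntegral.integral_congr fun s hs => ?_ <;>
    rw [uIcc_of_le zero_le_one] at hs
  · simp only [h _ (γ.path_mem hs)]
  · simp only [h _ (γ.conj_path_mem hs)]

namespace SymmetricLoop.IsSchwarz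

variable {γ : SymmetricLoop} {f : ℂ → ℂ}

theorem integrable_upper {σ : ℤ} (hf : γ.IsSchwarz f) (hσ : σ = 1 ∨ σ = -1) {α : ℂ}
    (hα : α ∉ γ.trace) {k : ℂ → ℂ} (hk : ContinuousOn k γ.trace) :
    IntervalIntegrable (fun s => f (γ.path s) * k (γ.path s) / rootAlong γ σ α s *
      deriv γ.path s) volume 0 1 := by
  refine γ.integrable_deriv.continuousOn_mul ?_
  rw [uIcc_of_le zero_le_one]
  exact (hf.continuousOn.mul (hk.comp γ.continuousOn_path fun s hs => γ.path_mem hs)).div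
    (continuousOn_rootAlong σ hα) fun s hs => rootAlong_ne_zero hσ hα hs

theorem radIntegrable {σ : ℤ} (hf : γ.IsSchwarz f) (hσ : σ = 1 ∨ σ = -1) {α : ℂ}
    (hα : α ∉ γ.trace) {k : ℂ → ℂ} (hk : ContinuousOn k γ.trace) :
    RadIntegrable γ σ α (fun ζ => f ζ * k ζ) := by
  refine ⟨hf.integrable_upper hσ hα hk, ?_⟩
  have hk' : ContinuousOn (fun ζ => conj (k (conj ζ))) γ.trace :=
    Complex.continuous_conj.comp_continuousOn
      (hk.comp Complex.continuous_conj.continuousOn fun z hz => conj_mem_trace hz)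
  have h := hf.integrable_upper (σ := σ) hσ hα hk'
  have h2 : IntervalIntegrable (fun s => conj (f (γ.path s) * conj (k (conj (γ.path s))) /
      rootAlong γ σ α s * deriv γ.path s)) volume 0 1 :=
    ⟨Complex.conjCLE.toContinuousLinearMap.integrable_comp h.1,
      Complex.conjCLE.toContinuousLinearMap.integrable_comp h.2⟩
  -- Only the open interval may be used: at the real endpoints `f` may jump and no symmetry is
  -- assumed.
  refine h2.congr_uIoo fun s hs => ?_
  rw [uIoo_of_le zero_le_one] at hs
  simp only [hf.map_conj _ (γ.upper s hs).ne', map_mul, map_div₀, Complex.conj_conj]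

/-- Reflection carries the lower half to the upper half. All later analysis is therefore done on
upper integrals only. -/
theorem radIntegral_eq (hf : γ.IsSchwarz f) (σ : ℤ) (α : ℂ) {k k' : ℂ → ℂ}
    (hk : ∀ ζ : ℂ, k (conj ζ) = conj (k' ζ)) :
    radIntegral γ σ α (fun ζ => f ζ * k ζ) =
      (∫ s in (0 : ℝ)..1, f (γ.path s) * k (γ.path s) / rootAlong γ σ α s * deriv γ.path s) -
      conj (∫ s in (0 : ℝ)..1, f (γ.path s) * k' (γ.path s) / rootAlong γ σ α s *
        deriv γ.path s) := by
  rw [radIntegral, loopIntegral, ← integral_conj_interval]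
  congr 1
  refine intervalIntegral.integral_congr_Ioo_of_le zero_le_one fun s hs => ?_
  simp only [hf.map_conj _ (γ.upper s hs).ne', hk, map_mul, map_div₀]

/-- The sign comes from conjugation reversing the orientation of the loop. -/
theorem radIntegral_conj (hf : γ.IsSchwarz f) (σ : ℤ) (α : ℂ) {k k' : ℂ → ℂ}
    (hk : ∀ ζ : ℂ, k (conj ζ) = conj (k' ζ)) :
    radIntegral γ σ α (fun ζ => f ζ * k' ζ) = -conj (radIntegral γ σ α (fun ζ => f ζ * k ζ)) := by
  have hk' : ∀ ζ : ℂ, k' (conj ζ) = conj (k ζ) := fun ζ => by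
    rw [← Complex.conj_conj (k' (conj ζ)), ← hk, Complex.conj_conj]
  rw [hf.radIntegral_eq σ α hk', hf.radIntegral_eq σ α hk]
  simp

theorem cauchy_conj (hf : γ.IsSchwarz f) (σ : ℤ) (α z : ℂ) :
    cauchy γ σ α f (conj z) = -conj (cauchy γ σ α f z) := by
  rw [cauchy_eq_radIntegral, cauchy_eq_radIntegral]
  exact hf.radIntegral_conj σ α fun ζ => by simp

theorem add {g : ℂ → ℂ} (hf : γ.IsSchwarz f) (hg : γ.IsSchwarz g) :
    γ.IsSchwarz (fun z => f z + g z) where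
  map_conj z hz := by rw [hf.map_conj z hz, hg.map_conj z hz, map_add]
  continuousOn := hf.continuousOn.add hg.continuousOn

end SymmetricLoop.IsSchwarz

theorem isSchwarz_of_continuous (γ : SymmetricLoop) {k : ℂ → ℂ}
    (hk : ∀ z, k (conj z) = conj (k z)) (hc : Continuous k) : γ.IsSchwarz k where
  map_conj z _ := hk z
  continuousOn := hc.comp_continuousOn γ.continuousOn_path

theorem isSchwarz_one (γ : SymmetricLoop) : γ.IsSchwarz (fun _ => 1) :=
  isSchwarz_of_continuous γ (by simp) continuous_const

theorem isSchwarz_id (γ : SymmetricLoop) : γ.IsSchwarz (fun ζ => ζ) :=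
  isSchwarz_of_continuous γ (by simp) continuous_id

theorem isSchwarz_sq (γ : SymmetricLoop) : γ.IsSchwarz (fun ζ => ζ ^ 2) :=
  isSchwarz_of_continuous γ (by simp) (continuous_pow 2)

theorem SymmetricLoop.IsSchwarz.phase {γ : SymmetricLoop} {f : ℂ → ℂ} (hf : γ.IsSchwarz f)
    (x t : ℝ) : γ.IsSchwarz (GenusZero.phase f x t) :=
  (hf.add (isSchwarz_of_continuous γ (k := fun ζ => 2 * ζ * x)
      (by simp [map_ofNat (starRingEnd ℂ) 2]) (by fun_prop))).add
    (isSchwarz_of_continuous γ (k := fun ζ => 2 * t * ζ ^ 2)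
      (by simp [map_ofNat (starRingEnd ℂ) 2]) (by fun_prop))

theorem continuousOn_inv_sub {γ : SymmetricLoop} {z : ℂ} (hz : z ∉ γ.trace) :
    ContinuousOn (fun ζ : ℂ => 1 / (ζ - z)) γ.trace :=
  continuousOn_const.div (by fun_prop) fun _ hζ => sub_ne_of_mem_of_notMem hζ hz

theorem SymmetricLoop.IsSchwarz.cauchy_phase {γ : SymmetricLoop} {σ : ℤ} {f : ℂ → ℂ}
    (hf : γ.IsSchwarz f) (hσ : σ = 1 ∨ σ = -1) {α z : ℂ} (hα : α ∉ γ.trace) (hz : z ∉ γ.trace)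
    (x t : ℝ) :
    cauchy γ σ α (GenusZero.phase f x t) z = cauchy γ σ α f z +
      2 * x * cauchy γ σ α (fun ζ => ζ) z + 2 * t * cauchy γ σ α (fun ζ => ζ ^ 2) z := by
  have hk := continuousOn_inv_sub hz
  have i0 := hf.radIntegrable hσ hα hk
  have i1 := ((isSchwarz_id γ).radIntegrable hσ hα hk).const_mul (2 * x)
  have i2 := ((isSchwarz_sq γ).radIntegrable hσ hα hk).const_mul (2 * t)
  simp only [cauchy_eq_radIntegral]
  rw [← radIntegral_const_mul, ← radIntegral_const_mul, ← radIntegral_add i0 i1,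
    ← radIntegral_add (i0.add i1) i2]
  congr 1
  ext ζ
  simp only [GenusZero.phase]
  ring

/-! ### Differentiation of integrals along the loop with respect to parameters -/

/-- The real-linear map `v ↦ p v + q v̄`, i.e. `p dα + q dᾱ`. -/
def wirtingerCLM (p q : ℂ) : ℂ →L[ℝ] ℂ :=
  p • (1 : ℂ →L[ℝ] ℂ) + q • (Complex.conjCLE : ℂ →L[ℝ] ℂ)

@[simp] theorem wirtingerCLM_apply (p q v : ℂ) : wirtingerCLM p q v = p * v + q * conj v := by
  simp [wirtingerCLM]

/-- Derivatives are carried in the form `wirtingerCLM p q`, so that both Wirtinger derivatives can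
be read off from one `HasFDerivAt`. -/
theorem wirtinger_eq {g : ℂ → ℂ} {p q α : ℂ} (h : HasFDerivAt g (wirtingerCLM p q) α) :
    wirtinger g α = p := by
  rw [wirtinger, h.fderiv]
  simp
  linear_combination (-p / 2 + q / 2) * Complex.I_sq

theorem wirtingerBar_eq {g : ℂ → ℂ} {p q α : ℂ} (h : HasFDerivAt g (wirtingerCLM p q) α) :
    wirtingerBar g α = q := by
  rw [wirtingerBar, h.fderiv]
  simp
  linear_combination (p / 2 - q / 2) * Complex.I_sq

theorem hasFDerivAt_wirtingerCLM_id (α : ℂ) : HasFDerivAt (fun a : ℂ => a) (wirtingerCLM 1 0) α :=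
  (hasFDerivAt_id α).congr_fderiv (by ext v; simp)

theorem hasFDerivAt_wirtingerCLM_const (c α : ℂ) :
    HasFDerivAt (fun _ : ℂ => c) (wirtingerCLM 0 0) α :=
  (hasFDerivAt_const c α).congr_fderiv (by ext v; simp)

theorem HasFDerivAt.conj_wirtinger {g : ℂ → ℂ} {p q α : ℂ}
    (h : HasFDerivAt g (wirtingerCLM p q) α) :
    HasFDerivAt (fun a => conj (g a)) (wirtingerCLM (conj q) (conj p)) α :=
  ((Complex.conjCLE.toContinuousLinearMap.hasFDerivAt (x := g α)).comp α h).congr_fderiv (by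
    ext v
    simp
    ring)

theorem HasFDerivAt.mul_wirtinger {g k : ℂ → ℂ} {p q p' q' α : ℂ}
    (h : HasFDerivAt g (wirtingerCLM p q) α) (h' : HasFDerivAt k (wirtingerCLM p' q') α) :
    HasFDerivAt (fun a => g a * k a)
      (wirtingerCLM (p * k α + g α * p') (q * k α + g α * q')) α :=
  (h.mul h').congr_fderiv (by
    ext v
    simp
    ring)

theorem HasFDerivAt.sub_wirtinger {g k : ℂ → ℂ} {p q p' q' α : ℂ}
    (h : HasFDerivAt g (wirtingerCLM p q) α) (h' : HasFDerivAt k (wirtingerCLM p' q') α) :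
    HasFDerivAt (fun a => g a - k a) (wirtingerCLM (p - p') (q - q')) α :=
  (h.sub h').congr_fderiv (by
    ext v
    simp
    ring)

theorem HasFDerivAt.const_mul_wirtinger {g : ℂ → ℂ} {p q α : ℂ}
    (h : HasFDerivAt g (wirtingerCLM p q) α) (c : ℂ) :
    HasFDerivAt (fun a => c * g a) (wirtingerCLM (c * p) (c * q)) α :=
  (h.const_mul c).congr_fderiv (by
    ext v
    simp
    ring)

/-- Differentiation under the integral sign when the kernel is smooth near a compact set. -/
theorem hasFDerivAt_integral_mul_kernel {E : Type*} [NormedAddCommGroup E] [NormedSpace ℂ E]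
    [ProperSpace E] {Ψ : E × ℂ → ℂ} {U : Set (E × ℂ)} (hU : IsOpen U) (hΨ : ContDiffOn ℂ 1 Ψ U)
    {c : ℝ → ℂ} (hc : ContinuousOn c (Icc 0 1)) {x₀ : E} (hx₀ : ∀ s ∈ Icc (0 : ℝ) 1, (x₀, c s) ∈ U)
    {g : ℝ → ℂ} (hg : IntervalIntegrable g volume 0 1) :
    IntervalIntegrable (fun s => g s • (fderiv ℂ Ψ (x₀, c s)).comp (ContinuousLinearMap.inl ℂ E ℂ))
      volume 0 1 ∧
    HasFDerivAt (fun x => ∫ s in (0 : ℝ)..1, g s * Ψ (x, c s))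
      (∫ s in (0 : ℝ)..1, g s • (fderiv ℂ Ψ (x₀, c s)).comp (ContinuousLinearMap.inl ℂ E ℂ)) x₀ := by
  have hK : IsCompact (c '' Icc (0 : ℝ) 1) := isCompact_Icc.image_of_continuousOn hc
  -- One ball of parameters works for all `s` at once. Compactness of its product with the curve
  -- then bounds the derivative, which gives the dominating function `‖g s‖ * C`.
  obtain ⟨u, v, hu, -, hxu, hKv, huv⟩ := generalized_tube_lemma (isCompact_singleton (x := x₀)) hK
    hU (by
      rintro ⟨x, z⟩ ⟨hx, ⟨s, hs, rfl⟩⟩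
      obtain rfl : x = x₀ := hx
      exact hx₀ s hs)
  obtain ⟨ε, hε, hball⟩ := Metric.nhds_basis_closedBall.mem_iff.mp (hu.mem_nhds (hxu rfl))
  have hsub : ∀ x ∈ Metric.closedBall x₀ ε, ∀ s ∈ Icc (0 : ℝ) 1, (x, c s) ∈ U := fun x hx s hs =>
    huv ⟨hball hx, hKv ⟨s, hs, rfl⟩⟩
  have hcd : ContinuousOn (fun P => (fderiv ℂ Ψ P).comp (ContinuousLinearMap.inl ℂ E ℂ)) U :=
    (hΨ.continuousOn_fderiv_of_isOpen hU le_rfl).clm_comp continuousOn_const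
  obtain ⟨C, hC⟩ := ((isCompact_closedBall x₀ ε).prod hK).exists_bound_of_continuousOn
    (hcd.mono (by
      rintro ⟨x, z⟩ ⟨hx, ⟨s, hs, rfl⟩⟩
      exact hsub x hx s hs))
  have hpath : ∀ x ∈ Metric.closedBall x₀ ε, ContinuousOn (fun s => Ψ (x, c s)) (Icc 0 1) :=
    fun x hx => hΨ.continuousOn.comp (continuousOn_const.prodMk hc) fun s hs => hsub x hx s hs
  have hx₀' : x₀ ∈ Metric.closedBall x₀ ε := Metric.mem_closedBall_self hε.le
  have hint : ∀ x ∈ Metric.closedBall x₀ ε,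
      IntervalIntegrable (fun s => g s * Ψ (x, c s)) volume 0 1 := fun x hx =>
    hg.mul_continuousOn (by rw [uIcc_of_le zero_le_one]; exact hpath x hx)
  have hint' : IntervalIntegrable (fun s => g s •
      (fderiv ℂ Ψ (x₀, c s)).comp (ContinuousLinearMap.inl ℂ E ℂ)) volume 0 1 := by
    refine hg.smul_continuousOn ?_
    rw [uIcc_of_le zero_le_one]
    exact hcd.comp (continuousOn_const.prodMk hc) fun s hs => hsub x₀ hx₀' s hs
  refine ⟨hint', ?_⟩
  refine intervalIntegral.hasFDerivAt_integral_of_dominated_of_fderiv_le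
    (F' := fun x s => g s • (fderiv ℂ Ψ (x, c s)).comp (ContinuousLinearMap.inl ℂ E ℂ))
    (bound := fun s => ‖g s‖ * C)
    (Metric.closedBall_mem_nhds x₀ hε) ?_ (hint x₀ hx₀') ?_ ?_ (hg.norm.mul_const C) ?_
  · filter_upwards [Metric.closedBall_mem_nhds x₀ hε] with x hx
    exact (hint x hx).def'.aestronglyMeasurable
  · exact hint'.def'.aestronglyMeasurable
  · refine Eventually.of_forall fun s hs x hx => ?_
    rw [uIoc_of_le zero_le_one] at hs
    rw [norm_smul]
    exact mul_le_mul_of_nonneg_left (hC (x, c s) ⟨hx, ⟨s, Ioc_subset_Icc_self hs, rfl⟩⟩)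
      (norm_nonneg _)
  · refine Eventually.of_forall fun s hs x hx => ?_
    rw [uIoc_of_le zero_le_one] at hs
    have h1 : HasFDerivAt Ψ (fderiv ℂ Ψ (x, c s)) (x, c s) :=
      ((hΨ.contDiffAt (hU.mem_nhds (hsub x hx s (Ioc_subset_Icc_self hs)))).differentiableAt
        one_ne_zero).hasFDerivAt
    exact (h1.comp x (hasFDerivAt_prodMk_left x (c s))).const_mul (g s)

/-! ### Dependence of the radical on the branch point -/

/-- `1 / (R₊(ζ; p, q) (ζ - c))` divided by its value `1 / R₊(ζ; α, ᾱ)` for branch points `p`, `q`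
near `α`, `ᾱ`. -/
def localKernel (α : ℂ) (X : (ℂ × ℂ × ℂ) × ℂ) : ℂ :=
  ((X.2 - X.1.1) / (X.2 - α)) ^ (-1 / 2 : ℂ) *
    ((X.2 - X.1.2.1) / (X.2 - conj α)) ^ (-1 / 2 : ℂ) * (1 / (X.2 - X.1.2.2))

/-- The domain on which `localKernel` is smooth. -/
def localKernelDomain (α : ℂ) : Set ((ℂ × ℂ × ℂ) × ℂ) :=
  {X | X.2 ≠ α ∧ X.2 ≠ conj α ∧ X.2 ≠ X.1.2.2 ∧ ‖X.1.1 - α‖ < ‖X.2 - α‖ ∧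
    ‖X.1.2.1 - conj α‖ < ‖X.2 - conj α‖}

theorem isOpen_localKernelDomain (α : ℂ) : IsOpen (localKernelDomain α) := by
  refine IsOpen.inter (isOpen_ne_fun (by fun_prop) (by fun_prop)) ?_
  refine IsOpen.inter (isOpen_ne_fun (by fun_prop) (by fun_prop)) ?_
  refine IsOpen.inter (isOpen_ne_fun (by fun_prop) (by fun_prop)) ?_
  exact (isOpen_lt (f := fun X : (ℂ × ℂ × ℂ) × ℂ => ‖X.1.1 - α‖) (g := fun X => ‖X.2 - α‖)
    (by fun_prop) (by fun_prop)).inter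
    (isOpen_lt (f := fun X : (ℂ × ℂ × ℂ) × ℂ => ‖X.1.2.1 - conj α‖)
      (g := fun X => ‖X.2 - conj α‖) (by fun_prop) (by fun_prop))

/-- The ratio is `1 - (p - α) / (ζ - α)`, a point of the open unit disc about `1`, where principal
powers are analytic. -/
theorem ratio_mem_slitPlane {ζ α p : ℂ} (h : ‖p - α‖ < ‖ζ - α‖) :
    (ζ - p) / (ζ - α) ∈ Complex.slitPlane := by
  have hpos : 0 < ‖ζ - α‖ := (norm_nonneg _).trans_lt h
  have hne : ζ - α ≠ 0 := norm_pos_iff.mp hpos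
  have h1 : (ζ - p) / (ζ - α) = 1 + -((p - α) / (ζ - α)) := by
    field_simp
    ring
  rw [h1]
  refine Complex.mem_slitPlane_of_norm_lt_one ?_
  rw [norm_neg, norm_div, div_lt_one hpos]
  exact h

theorem contDiffOn_localKernel (α : ℂ) : ContDiffOn ℂ 1 (localKernel α) (localKernelDomain α) := by
  rintro X ⟨h1, h2, h3, h4, h5⟩
  have e1 : X.2 - α ≠ 0 := sub_ne_zero.mpr h1
  have e2 : X.2 - conj α ≠ 0 := sub_ne_zero.mpr h2
  have e3 : X.2 - X.1.2.2 ≠ 0 := sub_ne_zero.mpr h3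
  have s1 := ratio_mem_slitPlane h4
  have s2 := ratio_mem_slitPlane h5
  have q : AnalyticAt ℂ (fun X : (ℂ × ℂ × ℂ) × ℂ => X.2) X :=
    (ContinuousLinearMap.snd ℂ (ℂ × ℂ × ℂ) ℂ).analyticAt X
  have q1 : AnalyticAt ℂ (fun X : (ℂ × ℂ × ℂ) × ℂ => X.1.1) X :=
    ((ContinuousLinearMap.fst ℂ ℂ (ℂ × ℂ)).comp (ContinuousLinearMap.fst ℂ (ℂ × ℂ × ℂ) ℂ)).analyticAt X
  have q2 : AnalyticAt ℂ (fun X : (ℂ × ℂ × ℂ) × ℂ => X.1.2.1) X :=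
    ((ContinuousLinearMap.fst ℂ ℂ ℂ).comp ((ContinuousLinearMap.snd ℂ ℂ (ℂ × ℂ)).comp
      (ContinuousLinearMap.fst ℂ (ℂ × ℂ × ℂ) ℂ))).analyticAt X
  have q3 : AnalyticAt ℂ (fun X : (ℂ × ℂ × ℂ) × ℂ => X.1.2.2) X :=
    ((ContinuousLinearMap.snd ℂ ℂ ℂ).comp ((ContinuousLinearMap.snd ℂ ℂ (ℂ × ℂ)).comp
      (ContinuousLinearMap.fst ℂ (ℂ × ℂ × ℂ) ℂ))).analyticAt X
  have A1 := ((q.sub q1).fun_div (q.sub analyticAt_const) e1).cpow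
    (g := fun _ => (-1 / 2 : ℂ)) analyticAt_const s1
  have A2 := ((q.sub q2).fun_div (q.sub analyticAt_const) e2).cpow
    (g := fun _ => (-1 / 2 : ℂ)) analyticAt_const s2
  have A3 := (analyticAt_const (v := (1 : ℂ))).fun_div (q.sub q3) e3
  have A : AnalyticAt ℂ (localKernel α) X := (A1.mul A2).mul A3
  exact A.contDiffAt.contDiffWithinAt

/-- The linear form `a dp + b dq + c dz`. -/
def localKernelFDeriv (a b c : ℂ) : (ℂ × ℂ × ℂ) →L[ℂ] ℂ :=
  a • ContinuousLinearMap.fst ℂ ℂ (ℂ × ℂ) +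
    b • (ContinuousLinearMap.fst ℂ ℂ ℂ).comp (ContinuousLinearMap.snd ℂ ℂ (ℂ × ℂ)) +
    c • (ContinuousLinearMap.snd ℂ ℂ ℂ).comp (ContinuousLinearMap.snd ℂ ℂ (ℂ × ℂ))

@[simp] theorem localKernelFDeriv_apply (a b c : ℂ) (v : ℂ × ℂ × ℂ) :
    localKernelFDeriv a b c v = a * v.1 + b * v.2.1 + c * v.2.2 := by
  simp [localKernelFDeriv]

/-- At the base point both powers equal `1`, so each factor contributes only its logarithmic
derivative. The two branch points vary independently here, which keeps the derivative
complex-linear; `q = p̄` is imposed later. -/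
theorem hasFDerivAt_localKernel {α ζ z : ℂ} (h1 : ζ - α ≠ 0) (h2 : ζ - conj α ≠ 0)
    (h3 : ζ - z ≠ 0) :
    HasFDerivAt (fun x : ℂ × ℂ × ℂ => localKernel α (x, ζ))
      (localKernelFDeriv (1 / (2 * (ζ - α) * (ζ - z))) (1 / (2 * (ζ - conj α) * (ζ - z)))
        (1 / (ζ - z) ^ 2)) (α, conj α, z) := by
  have key : ∀ β : ℂ, ζ - β ≠ 0 →
      HasDerivAt (fun p => ((ζ - p) / (ζ - β)) ^ (-1 / 2 : ℂ)) (1 / (2 * (ζ - β))) β := by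
    intro β hβ
    have hd : HasDerivAt (fun p => (ζ - p) / (ζ - β)) (-1 / (ζ - β)) β :=
      ((hasDerivAt_id β).const_sub ζ).div_const _
    have := hd.cpow_const (c := (-1 / 2 : ℂ)) (by simp [div_self hβ])
    refine this.congr_deriv ?_
    rw [div_self hβ, Complex.one_cpow]
    field_simp
  have k3 : HasDerivAt (fun c => 1 / (ζ - c)) (1 / (ζ - z) ^ 2) z := by
    have := ((hasDerivAt_id z).const_sub ζ).inv h3
    simp only [neg_neg] at this
    simp only [one_div]
    exact this.congr_deriv (by simp)
  have p1 : HasFDerivAt (fun x : ℂ × ℂ × ℂ => x.1)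
      (ContinuousLinearMap.fst ℂ ℂ (ℂ × ℂ)) (α, conj α, z) := hasFDerivAt_fst
  have p' : HasFDerivAt (fun x : ℂ × ℂ × ℂ => x.2)
      (ContinuousLinearMap.snd ℂ ℂ (ℂ × ℂ)) (α, conj α, z) := hasFDerivAt_snd
  have p2 := p'.fst
  have p3 := p'.snd
  have d1 := HasDerivAt.comp_hasFDerivAt ((α, conj α, z) : ℂ × ℂ × ℂ) (key α h1) p1
  have d2 := HasDerivAt.comp_hasFDerivAt ((α, conj α, z) : ℂ × ℂ × ℂ) (key (conj α) h2) p2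
  have d3 := HasDerivAt.comp_hasFDerivAt ((α, conj α, z) : ℂ × ℂ × ℂ) k3 p3
  refine ((d1.mul d2).mul d3).congr_fderiv ?_
  ext <;> simp [div_self h1, div_self h2]

/-- The right-hand side is a continuous square root of the new radicand with the correct value at
the start, so `eq_rootAlong` identifies it. -/
theorem rootAlong_eq_mul {γ : SymmetricLoop} {σ : ℤ} (hσ : σ = 1 ∨ σ = -1) {α a : ℂ}
    (hα : α ∉ γ.trace) (ha : a ∉ γ.trace)
    (hnear : ∀ s ∈ Icc (0 : ℝ) 1,
      ‖a - α‖ < ‖γ.path s - α‖ ∧ ‖conj a - conj α‖ < ‖γ.path s - conj α‖)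
    {s : ℝ} (hs : s ∈ Ioo (0 : ℝ) 1) :
    rootAlong γ σ a s = rootAlong γ σ α s *
      (((γ.path s - a) / (γ.path s - α)) ^ (1 / 2 : ℂ) *
        ((γ.path s - conj a) / (γ.path s - conj α)) ^ (1 / 2 : ℂ)) := by
  symm
  have hcont : ContinuousOn (fun s => rootAlong γ σ α s *
      (((γ.path s - a) / (γ.path s - α)) ^ (1 / 2 : ℂ) *
        ((γ.path s - conj a) / (γ.path s - conj α)) ^ (1 / 2 : ℂ))) (Icc 0 1) := by
    refine (continuousOn_rootAlong σ hα).mul (ContinuousOn.mul ?_ ?_)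
    · exact ContinuousOn.cpow (((γ.continuousOn_path.sub continuousOn_const)).div
        (γ.continuousOn_path.sub continuousOn_const) fun s hs => (path_sub_ne hα hs).1)
        continuousOn_const fun s hs => ratio_mem_slitPlane (hnear s hs).1
    · exact ContinuousOn.cpow (((γ.continuousOn_path.sub continuousOn_const)).div
        (γ.continuousOn_path.sub continuousOn_const) fun s hs => (path_sub_ne hα hs).2)
        continuousOn_const fun s hs => ratio_mem_slitPlane (hnear s hs).2
  have hsqrt : ∀ y : ℂ, (y ^ (1 / 2 : ℂ)) ^ 2 = y := fun y => by
    rw [one_div, Complex.cpow_ofNat_inv_pow]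
  refine eq_rootAlong (ρ := fun s => rootAlong γ σ α s *
      (((γ.path s - a) / (γ.path s - α)) ^ (1 / 2 : ℂ) *
        ((γ.path s - conj a) / (γ.path s - conj α)) ^ (1 / 2 : ℂ))) hσ ha
    (hcont.mono Ioo_subset_Icc_self) (fun s hs => ?_) ?_ s hs
  · have hs' := Ioo_subset_Icc_self hs
    obtain ⟨n1, n2⟩ := path_sub_ne hα hs'
    simp only [mul_pow]
    rw [hsqrt, hsqrt, rootAlong_sq hσ hα hs', radicand, radicand]
    field_simp
  · have h0 : (0 : ℝ) ∈ Icc (0 : ℝ) 1 := by simp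
    have h1 := (hcont 0 h0).mono_left (nhdsWithin_le_of_mem (a := (0 : ℝ)) (s := Icc 0 1)
      (t := Ioi 0) (mem_of_superset (Ioo_mem_nhdsGT zero_lt_one) Ioo_subset_Icc_self))
    convert h1 using 2
    have hreal : conj (γ.path 0) = γ.path 0 := Complex.conj_eq_iff_im.mpr γ.start_real
    have hn := path_sub_ne hα h0
    have hslit := ratio_mem_slitPlane (hnear 0 h0).1
    -- Since `γ(0)` is real, the two ratios are conjugate there, and the product of their principal
    -- roots is the positive number `|γ(0) - a| / |γ(0) - α|`.
    have hconj : (γ.path 0 - conj a) / (γ.path 0 - conj α) =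
        conj ((γ.path 0 - a) / (γ.path 0 - α)) := by
      rw [map_div₀, map_sub, map_sub, hreal]
    have hcp : conj ((γ.path 0 - a) / (γ.path 0 - α)) ^ (1 / 2 : ℂ) =
        conj (((γ.path 0 - a) / (γ.path 0 - α)) ^ (1 / 2 : ℂ)) := by
      rw [Complex.conj_cpow _ _ (Complex.slitPlane_arg_ne_pi hslit)]
      simp [map_ofNat (starRingEnd ℂ) 2]
    beta_reduce
    rw [hconj, hcp, Complex.mul_conj', ← Complex.ofReal_pow, ← norm_pow, hsqrt, norm_div,
      rootAlong_zero]
    have : ‖γ.path 0 - α‖ ≠ 0 := norm_ne_zero_iff.mpr hn.1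
    rw [← Complex.ofReal_mul]
    field_simp
    push_cast
    ring

/-- `∫ f(ζ) k(ζ) dζ / R(ζ)` over the upper half of the loop. -/
def upperIntegral (γ : SymmetricLoop) (σ : ℤ) (α : ℂ) (f k : ℂ → ℂ) : ℂ :=
  ∫ s in (0 : ℝ)..1, f (γ.path s) * k (γ.path s) / rootAlong γ σ α s * deriv γ.path s

/-- `∮ f(ζ) / ((ζ - b) (ζ - c) R(ζ)) dζ`. -/
def doubleCauchy (γ : SymmetricLoop) (σ : ℤ) (α : ℂ) (f : ℂ → ℂ) (b c : ℂ) : ℂ :=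
  radIntegral γ σ α (fun ζ => f ζ * (1 / ((ζ - b) * (ζ - c))))

theorem continuousOn_inv_sub_mul_sub {γ : SymmetricLoop} {b c : ℂ} (hb : b ∉ γ.trace)
    (hc : c ∉ γ.trace) : ContinuousOn (fun ζ : ℂ => 1 / ((ζ - b) * (ζ - c))) γ.trace :=
  continuousOn_const.div (by fun_prop) fun _ hζ =>
    mul_ne_zero (sub_ne_of_mem_of_notMem hζ hb) (sub_ne_of_mem_of_notMem hζ hc)

namespace SymmetricLoop.IsSchwarz

variable {γ : SymmetricLoop} {f : ℂ → ℂ}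

theorem cauchy_eq_sub (hf : γ.IsSchwarz f) (σ : ℤ) (α z : ℂ) :
    cauchy γ σ α f z = upperIntegral γ σ α f (fun ζ => 1 / (ζ - z)) -
      conj (upperIntegral γ σ α f (fun ζ => 1 / (ζ - conj z))) := by
  rw [cauchy_eq_radIntegral]
  exact hf.radIntegral_eq σ α (k := fun ζ => 1 / (ζ - z)) (k' := fun ζ => 1 / (ζ - conj z))
    fun ζ => by simp only [map_div₀, map_sub, Complex.conj_conj, map_one]

theorem doubleCauchy_eq_sub (hf : γ.IsSchwarz f) (σ : ℤ) (α b c : ℂ) :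
    doubleCauchy γ σ α f b c = upperIntegral γ σ α f (fun ζ => 1 / ((ζ - b) * (ζ - c))) -
      conj (upperIntegral γ σ α f (fun ζ => 1 / ((ζ - conj b) * (ζ - conj c)))) :=
  hf.radIntegral_eq σ α (k := fun ζ => 1 / ((ζ - b) * (ζ - c)))
    (k' := fun ζ => 1 / ((ζ - conj b) * (ζ - conj c)))
    fun ζ => by simp only [map_div₀, map_mul, map_sub, Complex.conj_conj, map_one]

/-- Partial fractions. -/
theorem sub_mul_doubleCauchy {σ : ℤ} (hf : γ.IsSchwarz f) (hσ : σ = 1 ∨ σ = -1) {α b c : ℂ}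
    (hα : α ∉ γ.trace) (hb : b ∉ γ.trace) (hc : c ∉ γ.trace) :
    (b - c) * doubleCauchy γ σ α f b c = cauchy γ σ α f b - cauchy γ σ α f c := by
  have ib := hf.radIntegrable hσ hα (continuousOn_inv_sub hb)
  have ic := (hf.radIntegrable hσ hα (continuousOn_inv_sub hc)).const_mul (-1)
  rw [doubleCauchy, ← radIntegral_const_mul, cauchy_eq_radIntegral, cauchy_eq_radIntegral,
    sub_eq_add_neg (radIntegral _ _ _ _), ← neg_one_mul (radIntegral _ _ _ _),
    ← radIntegral_const_mul γ σ α (-1), ← radIntegral_add ib ic]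
  refine radIntegral_congr fun ζ hζ => ?_
  have h1 := sub_ne_of_mem_of_notMem hζ hb
  have h2 := sub_ne_of_mem_of_notMem hζ hc
  field_simp
  ring

/-- The weight `f / R₊` is frozen at the base branch point and the parameters occur only in the
analytic kernel, so no smoothness of `f` is needed. -/
theorem hasFDerivAt_localKernel {σ : ℤ} (hf : γ.IsSchwarz f) (hσ : σ = 1 ∨ σ = -1) {α z : ℂ}
    (hα : α ∉ γ.trace) (hz : z ∉ γ.trace) :
    HasFDerivAt (fun x : ℂ × ℂ × ℂ => ∫ s in (0 : ℝ)..1,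
        f (γ.path s) / rootAlong γ σ α s * deriv γ.path s * localKernel α (x, γ.path s))
      (localKernelFDeriv (1 / 2 * upperIntegral γ σ α f (fun ζ => 1 / ((ζ - α) * (ζ - z))))
        (1 / 2 * upperIntegral γ σ α f (fun ζ => 1 / ((ζ - conj α) * (ζ - z))))
        (upperIntegral γ σ α f (fun ζ => 1 / ((ζ - z) * (ζ - z))))) (α, conj α, z) := by
  have hα' := conj_notMem_trace hα
  have hg : IntervalIntegrable
      (fun s => f (γ.path s) / rootAlong γ σ α s * deriv γ.path s) volume 0 1 := by
    have h := hf.integrable_upper (σ := σ) hσ hα (k := fun _ => 1) continuousOn_const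
    simpa using h
  have hdom : ∀ s ∈ Icc (0 : ℝ) 1, ((α, conj α, z), γ.path s) ∈ localKernelDomain α := by
    intro s hs
    have n1 := sub_ne_of_mem_of_notMem (γ.path_mem hs) hα
    have n2 := sub_ne_of_mem_of_notMem (γ.path_mem hs) hα'
    have n3 := sub_ne_of_mem_of_notMem (γ.path_mem hs) hz
    refine ⟨sub_ne_zero.mp n1, sub_ne_zero.mp n2, sub_ne_zero.mp n3, ?_, ?_⟩
    · simpa using n1
    · simpa using n2
  obtain ⟨hint, hd⟩ := hasFDerivAt_integral_mul_kernel (isOpen_localKernelDomain α)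
    (contDiffOn_localKernel α) γ.continuousOn_path hdom hg
  have hfd : ∀ s ∈ Icc (0 : ℝ) 1,
      (fderiv ℂ (localKernel α) ((α, conj α, z), γ.path s)).comp
        (ContinuousLinearMap.inl ℂ (ℂ × ℂ × ℂ) ℂ) =
      localKernelFDeriv (1 / (2 * (γ.path s - α) * (γ.path s - z)))
        (1 / (2 * (γ.path s - conj α) * (γ.path s - z))) (1 / (γ.path s - z) ^ 2) := by
    intro s hs
    have h1 : HasFDerivAt (localKernel α) (fderiv ℂ (localKernel α) ((α, conj α, z), γ.path s))
        ((α, conj α, z), γ.path s) :=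
      (((contDiffOn_localKernel α).contDiffAt ((isOpen_localKernelDomain α).mem_nhds
        (hdom s hs))).differentiableAt one_ne_zero).hasFDerivAt
    have h0 : HasFDerivAt (fun e : ℂ × ℂ × ℂ => (e, γ.path s))
        (ContinuousLinearMap.inl ℂ (ℂ × ℂ × ℂ) ℂ) (α, conj α, z) :=
      hasFDerivAt_prodMk_left (α, conj α, z) (γ.path s)
    -- Uniqueness of derivatives identifies the restriction of the joint derivative to the
    -- parameters with the explicit linear form.
    exact (HasFDerivAt.comp (g := localKernel α) (α, conj α, z) h1 h0).unique
      (GenusZero.hasFDerivAt_localKernel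
      (sub_ne_of_mem_of_notMem (γ.path_mem hs) hα)
      (sub_ne_of_mem_of_notMem (γ.path_mem hs) hα')
      (sub_ne_of_mem_of_notMem (γ.path_mem hs) hz))
  have happ : ∀ v : ℂ × ℂ × ℂ, (∫ s in (0 : ℝ)..1,
      (f (γ.path s) / rootAlong γ σ α s * deriv γ.path s) •
        (fderiv ℂ (localKernel α) ((α, conj α, z), γ.path s)).comp
          (ContinuousLinearMap.inl ℂ (ℂ × ℂ × ℂ) ℂ)) v =
      ∫ s in (0 : ℝ)..1, (f (γ.path s) / rootAlong γ σ α s * deriv γ.path s) *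
        (1 / (2 * (γ.path s - α) * (γ.path s - z)) * v.1 +
        1 / (2 * (γ.path s - conj α) * (γ.path s - z)) * v.2.1 +
        1 / (γ.path s - z) ^ 2 * v.2.2) := by
    intro v
    rw [ContinuousLinearMap.intervalIntegral_apply hint]
    refine intervalIntegral.integral_congr fun s hs => ?_
    rw [uIcc_of_le zero_le_one] at hs
    simp only [hfd s hs, smul_apply, localKernelFDeriv_apply, smul_eq_mul]
  refine hd.congr_fderiv ?_
  ext <;> simp only [ContinuousLinearMap.comp_apply, ContinuousLinearMap.inl_apply,
      ContinuousLinearMap.inr_apply, happ, localKernelFDeriv_apply, upperIntegral, Prod.fst_zero,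
      Prod.snd_zero, ← intervalIntegral.integral_const_mul, mul_zero, add_zero, mul_one, zero_add]
  all_goals
    refine intervalIntegral.integral_congr fun s hs => ?_
    simp only [mul_inv, div_eq_mul_inv, ← inv_pow]
    ring

theorem upperIntegral_eq_localKernel {σ : ℤ} (hσ : σ = 1 ∨ σ = -1) {α a : ℂ}
    (hα : α ∉ γ.trace) (ha : a ∉ γ.trace)
    (hnear : ∀ s ∈ Icc (0 : ℝ) 1,
      ‖a - α‖ < ‖γ.path s - α‖ ∧ ‖conj a - conj α‖ < ‖γ.path s - conj α‖) (z : ℂ) :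
    upperIntegral γ σ a f (fun ζ => 1 / (ζ - z)) = ∫ s in (0 : ℝ)..1,
        f (γ.path s) / rootAlong γ σ α s * deriv γ.path s *
          localKernel α ((a, conj a, z), γ.path s) := by
  refine intervalIntegral.integral_congr_Ioo_of_le zero_le_one fun s hs => ?_
  have hneg : ∀ y : ℂ, y ^ (-1 / 2 : ℂ) = (y ^ (1 / 2 : ℂ))⁻¹ := fun y => by
    rw [neg_div, Complex.cpow_neg]
  simp only [rootAlong_eq_mul hσ hα ha hnear hs, localKernel, hneg]
  generalize ((γ.path s - a) / (γ.path s - α)) ^ (1 / 2 : ℂ) = u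
  generalize ((γ.path s - conj a) / (γ.path s - conj α)) ^ (1 / 2 : ℂ) = v
  simp only [div_eq_mul_inv, mul_inv]
  ring

theorem eventually_near {α : ℂ} (hα : α ∉ γ.trace) :
    ∀ᶠ a in 𝓝 α, a ∉ γ.trace ∧ ∀ s ∈ Icc (0 : ℝ) 1,
      ‖a - α‖ < ‖γ.path s - α‖ ∧ ‖conj a - conj α‖ < ‖γ.path s - conj α‖ := by
  obtain ⟨ε, hε, hball⟩ := Metric.isOpen_iff.mp γ.isOpen_compl_trace α hα
  filter_upwards [Metric.ball_mem_nhds α hε] with a ha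
  refine ⟨hball ha, fun s hs => ?_⟩
  have key : ∀ ζ ∈ γ.trace, ε ≤ ‖ζ - α‖ := by
    intro ζ hζ
    by_contra! h
    exact hball (mem_ball_iff_norm.mpr h) hζ
  have ha' : ‖a - α‖ < ε := mem_ball_iff_norm.mp ha
  refine ⟨ha'.trans_le (key _ (γ.path_mem hs)), ?_⟩
  -- The distance from `γ(s)` to `ᾱ` is that from its mirror image, also on the loop, to `α`.
  have h2 := key _ (γ.conj_path_mem hs)
  rw [← map_sub, RCLike.norm_conj]
  rw [← RCLike.norm_conj, map_sub, Complex.conj_conj] at h2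
  exact ha'.trans_le h2

/-- The pole `c` may move with the branch point: it is constant for `h` and is `α` itself for `w`.
The lower half of the loop needs the conjugate of `c` as well. -/
theorem hasFDerivAt_upperIntegral {σ : ℤ} (hf : γ.IsSchwarz f) (hσ : σ = 1 ∨ σ = -1) {α : ℂ}
    (hα : α ∉ γ.trace) {c : ℂ → ℂ} {c₁ c₂ : ℂ} (hc : HasFDerivAt c (wirtingerCLM c₁ c₂) α)
    (hz : c α ∉ γ.trace) :
    HasFDerivAt (fun a => upperIntegral γ σ a f (fun ζ => 1 / (ζ - c a)))
      (wirtingerCLM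
        (1 / 2 * upperIntegral γ σ α f (fun ζ => 1 / ((ζ - α) * (ζ - c α))) +
          c₁ * upperIntegral γ σ α f (fun ζ => 1 / ((ζ - c α) * (ζ - c α))))
        (1 / 2 * upperIntegral γ σ α f (fun ζ => 1 / ((ζ - conj α) * (ζ - c α))) +
          c₂ * upperIntegral γ σ α f (fun ζ => 1 / ((ζ - c α) * (ζ - c α))))) α := by
  have h1 := (hf.hasFDerivAt_localKernel (σ := σ) hσ hα hz).restrictScalars ℝ
  have h2 : HasFDerivAt (fun a : ℂ => (a, conj a, c a)) _ α :=
    (hasFDerivAt_id (𝕜 := ℝ) α).prodMk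
      ((Complex.conjCLE.toContinuousLinearMap.hasFDerivAt (x := α)).prodMk hc)
  have h3 := HasFDerivAt.comp (g := fun x : ℂ × ℂ × ℂ => ∫ s in (0 : ℝ)..1,
    f (γ.path s) / rootAlong γ σ α s * deriv γ.path s * localKernel α (x, γ.path s)) α h1 h2
  refine (h3.congr_fderiv ?_).congr_of_eventuallyEq ?_
  · ext v
    simp
    ring
  · filter_upwards [eventually_near hα] with a ha
    exact upperIntegral_eq_localKernel hσ hα ha.1 ha.2 (c a)

theorem hasFDerivAt_cauchy {σ : ℤ} (hf : γ.IsSchwarz f) (hσ : σ = 1 ∨ σ = -1) {α : ℂ}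
    (hα : α ∉ γ.trace) {c : ℂ → ℂ} {c₁ c₂ : ℂ} (hc : HasFDerivAt c (wirtingerCLM c₁ c₂) α)
    (hz : c α ∉ γ.trace) :
    HasFDerivAt (fun a => cauchy γ σ a f (c a))
      (wirtingerCLM
        (1 / 2 * doubleCauchy γ σ α f α (c α) + c₁ * doubleCauchy γ σ α f (c α) (c α))
        (1 / 2 * doubleCauchy γ σ α f (conj α) (c α) +
          c₂ * doubleCauchy γ σ α f (c α) (c α))) α := by
  have h1 := hf.hasFDerivAt_upperIntegral (σ := σ) hσ hα hc hz
  have h2 := (hf.hasFDerivAt_upperIntegral (σ := σ) hσ hα hc.conj_wirtinger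
    (conj_notMem_trace hz)).conj_wirtinger
  simp only [hf.cauchy_eq_sub, hf.doubleCauchy_eq_sub]
  refine (h1.sub_wirtinger h2).congr_fderiv ?_
  congr 1 <;> simp [map_ofNat (starRingEnd ℂ) 2] <;> ring

theorem hasDerivAt_cauchy {σ : ℤ} (hf : γ.IsSchwarz f) (hσ : σ = 1 ∨ σ = -1) {α z : ℂ}
    (hα : α ∉ γ.trace) (hz : z ∉ γ.trace) :
    HasDerivAt (fun z => cauchy γ σ α f z) (doubleCauchy γ σ α f z z) z := by
  have key : ∀ y ∉ γ.trace, HasDerivAt (fun z => upperIntegral γ σ α f (fun ζ => 1 / (ζ - z)))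
      (upperIntegral γ σ α f (fun ζ => 1 / ((ζ - y) * (ζ - y)))) y := by
    intro y hy
    have h1 := hf.hasFDerivAt_localKernel (σ := σ) hσ hα hy
    have h2 : HasDerivAt (fun z : ℂ => (α, conj α, z)) (0, 0, 1) y :=
      (hasDerivAt_const y α).prodMk ((hasDerivAt_const y (conj α)).prodMk (hasDerivAt_id y))
    have h3 := HasFDerivAt.comp_hasDerivAt (l := fun x : ℂ × ℂ × ℂ => ∫ s in (0 : ℝ)..1,
      f (γ.path s) / rootAlong γ σ α s * deriv γ.path s * localKernel α (x, γ.path s)) y h1 h2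
    refine (h3.congr_deriv (by simp)).congr_of_eventuallyEq (Eventually.of_forall fun z => ?_)
    -- Here the branch point stays at `α`, and only the pole moves.
    exact upperIntegral_eq_localKernel hσ hα hα (eventually_near hα).self_of_nhds.2 z
  -- The lower half contributes `z ↦ conj (U (conj z))` with `U` holomorphic, and this is again
  -- holomorphic.
  have h2 := (key _ (conj_notMem_trace hz)).conj_conj
  rw [Complex.conj_conj] at h2
  simp only [hf.cauchy_eq_sub, hf.doubleCauchy_eq_sub]
  exact (key z hz).sub h2

end SymmetricLoop.IsSchwarz

/-! ### The integrals of `1 / R`, `ζ / R` and `1 / ((ζ - z) R)` -/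

theorem radIntegral_eq_sub_conj (γ : SymmetricLoop) (σ : ℤ) (α : ℂ) {k k' : ℂ → ℂ}
    (hk : ∀ ζ : ℂ, k (conj ζ) = conj (k' ζ)) :
    radIntegral γ σ α k =
      (∫ s in (0 : ℝ)..1, k (γ.path s) / rootAlong γ σ α s * deriv γ.path s) -
      conj (∫ s in (0 : ℝ)..1, k' (γ.path s) / rootAlong γ σ α s * deriv γ.path s) := by
  simpa using (isSchwarz_one γ).radIntegral_eq σ α hk

/-- `R` is a primitive of `(ζ - Re α) / R`, and its end values are real, hence cancel against their
conjugates. -/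
theorem radIntegral_sub_re {γ : SymmetricLoop} {σ : ℤ} (hσ : σ = 1 ∨ σ = -1) {α : ℂ}
    (hα : α ∈ encircled γ σ) : radIntegral γ σ α (fun ζ => ζ - α.re) = 0 := by
  rw [radIntegral_eq_sub_conj γ σ α (k := fun ζ => ζ - α.re) (k' := fun ζ => ζ - α.re)
      fun ζ => by simp,
    integral_eq_sub_along γ (continuousOn_rootAlong σ hα.2.1)
      (fun s hs _ h => hasDerivAt_rootAlong hσ hα.2.1 hs h)
      ((γ.continuousOn_path.sub continuousOn_const).div (continuousOn_rootAlong σ hα.2.1)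
        fun s hs => rootAlong_ne_zero hσ hα.2.1 hs),
    map_sub, rootAlong_one_real hσ hα, rootAlong_zero_real]
  ring

/-- At a real point `R` dominates `ξ - Re α`, so that `ξ - Re α + R` has the sign of `R`. -/
theorem abs_sub_re_lt {α : ℂ} (hα : α.im ≠ 0) {ρ ξ : ℝ} (h : ρ ^ 2 = (ξ - α.re) ^ 2 + α.im ^ 2) :
    |ξ - α.re| < |ρ| := by
  rw [← sq_lt_sq, h]
  have := sq_pos_of_ne_zero hα
  linarith

/-- In the upper half-plane `ζ - Re α + R(ζ)` lies in the upper half-plane. -/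
theorem im_pos_of_sq_eq_radicand {α ζ r : ℂ} (hα : α.im ≠ 0) (hζ : 0 < ζ.im)
    (hr : r ^ 2 = radicand α ζ) : 0 < (ζ - α.re + r).im := by
  rw [radicand_eq] at hr
  set u := ζ - α.re + r with hu
  have hprod : u * (ζ - α.re - r) = -(α.im : ℂ) ^ 2 := by
    rw [hu]; linear_combination -hr
  have hb : (α.im : ℂ) ≠ 0 := by exact_mod_cast hα
  have hu0 : u ≠ 0 := by
    intro h
    rw [h, zero_mul] at hprod
    exact pow_ne_zero 2 hb (neg_eq_zero.mp hprod.symm)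
  -- Inverse Joukowski map: with `b = Im α`, `2 (ζ - Re α) = u - b² / u`, whose imaginary part is
  -- `Im u` times the positive number `1 + b² / |u|²`.
  have h2 : 2 * (ζ - α.re) = u + ((-(α.im ^ 2) : ℝ) : ℂ) * u⁻¹ := by
    have : ζ - α.re - r = -(α.im : ℂ) ^ 2 * u⁻¹ := by
      rw [← hprod]; field_simp
    push_cast
    rw [← this, hu]
    ring
  have h3 := congrArg Complex.im h2
  rw [Complex.add_im, Complex.im_ofReal_mul, Complex.inv_im] at h3
  simp only [Complex.mul_im, Complex.sub_im, Complex.ofReal_im, Complex.sub_re,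
    Complex.re_ofNat, Complex.im_ofNat, sub_zero, zero_mul, add_zero] at h3
  have hN : 0 < Complex.normSq u := Complex.normSq_pos.mpr hu0
  have h4 : 2 * ζ.im = u.im * (1 + α.im ^ 2 / Complex.normSq u) := by
    rw [h3]; field_simp
  have h5 : 0 < 1 + α.im ^ 2 / Complex.normSq u := by positivity
  have : 0 < u.im * (1 + α.im ^ 2 / Complex.normSq u) := by rw [← h4]; linarith
  exact (pos_iff_pos_of_mul_pos this).mpr h5

theorem im_log_neg_I_mul {x : ℝ} (hx : x ≠ 0) :
    (Complex.log (-Complex.I * x)).im = -(SignType.sign x : ℤ) * (Real.pi / 2) := by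
  rw [Complex.log_im]
  rcases hx.lt_or_gt with h | h
  · have : -Complex.I * x = ((-x : ℝ) : ℂ) * Complex.I := by push_cast; ring
    rw [this, Complex.arg_real_mul _ (neg_pos.mpr h), Complex.arg_I, sign_neg h]
    simp
  · rw [mul_comm, Complex.arg_real_mul _ h, Complex.arg_neg_I, sign_pos h]
    simp

/-- A primitive of `1 / R` is `log (ζ - Re α + R)`. Its argument stays in the upper half-plane and
is real and nonzero at the ends, so after multiplication by `-i` the principal logarithm is
continuous on the whole path. The sign change of `R₊` moves the imaginary part from `-σπ/2` to
`σπ/2`; subtracting the conjugate doubles this. -/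
theorem radIntegral_one {γ : SymmetricLoop} {σ : ℤ} (hσ : σ = 1 ∨ σ = -1) {α : ℂ}
    (hα : α ∈ encircled γ σ) :
    radIntegral γ σ α (fun _ => 1) = 2 * Real.pi * Complex.I * σ := by
  set u : ℝ → ℂ := fun s => γ.path s - α.re + rootAlong γ σ α s with hu
  have hRc := continuousOn_rootAlong (γ := γ) σ hα.2.1
  have huc : ContinuousOn u (Icc 0 1) :=
    (γ.continuousOn_path.sub continuousOn_const).add hRc
  have hend : ∀ s ∈ Icc (0 : ℝ) 1, (γ.path s).im = 0 → ∀ ρ : ℝ, rootAlong γ σ α s = ρ →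
      ∃ v : ℝ, u s = v ∧ v ≠ 0 ∧ SignType.sign v = SignType.sign ρ := by
    intro s hs him ρ hρ
    have hζ : γ.path s = (γ.path s).re := by
      apply Complex.ext <;> simp [him]
    have hsq := rootAlong_sq hσ hα.2.1 hs
    rw [hρ, radicand_eq, hζ] at hsq
    have hsq' : ρ ^ 2 = ((γ.path s).re - α.re) ^ 2 + α.im ^ 2 := by exact_mod_cast hsq
    have habs := abs_sub_re_lt hα.1 hsq'
    refine ⟨(γ.path s).re - α.re + ρ, by simp only [hu, hρ]; rw [hζ]; push_cast; simp, ?_⟩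
    have hρ0 : ρ ≠ 0 := by
      rintro rfl
      simp only [abs_zero] at habs
      exact absurd (abs_nonneg _) habs.not_ge
    rcases hρ0.lt_or_gt with h | h
    · rw [abs_of_neg h] at habs
      have := (abs_lt.mp habs).2
      have hv : (γ.path s).re - α.re + ρ < 0 := by linarith
      exact ⟨hv.ne, by rw [sign_neg hv, sign_neg h]⟩
    · rw [abs_of_pos h] at habs
      have := (abs_lt.mp habs).1
      have hv : 0 < (γ.path s).re - α.re + ρ := by linarith
      exact ⟨hv.ne', by rw [sign_pos hv, sign_pos h]⟩
  obtain ⟨ρ₁, hρ₁, hR₁⟩ := rootAlong_one hσ hα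
  have hρ₀ : 0 < ‖γ.path 0 - α‖ := norm_pos_iff.mpr (path_sub_ne hα.2.1 (by simp)).1
  obtain ⟨v₀, hv₀, hv₀0, hs₀⟩ := hend 0 (by simp) γ.start_real _ (rootAlong_zero γ σ α)
  obtain ⟨v₁, hv₁, hv₁0, hs₁⟩ := hend 1 (by simp) γ.end_real _ hR₁
  have hmid : ∀ s ∈ Ioo (0 : ℝ) 1, 0 < (u s).im := fun s hs =>
    im_pos_of_sq_eq_radicand hα.1 (γ.upper s hs)
      (rootAlong_sq hσ hα.2.1 (Ioo_subset_Icc_self hs))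
  have hslit : ∀ s ∈ Icc (0 : ℝ) 1, -Complex.I * u s ∈ Complex.slitPlane := by
    intro s hs
    rcases eq_or_lt_of_le hs.1 with rfl | h0
    · rw [hv₀]; right; simpa using hv₀0
    rcases eq_or_lt_of_le hs.2 with rfl | h1
    · rw [hv₁]; right; simpa using hv₁0
    · left; simpa using hmid s ⟨h0, h1⟩
  have hFTC := integral_eq_sub_along γ (G := fun s => Complex.log (-Complex.I * u s))
    (g := fun s => 1 / rootAlong γ σ α s)
    ((continuousOn_const.mul huc).clog hslit) (fun s hs hd hc => by
      have hs' := Ioo_subset_Icc_self hs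
      have hR := rootAlong_ne_zero hσ hα.2.1 hs'
      have hus : u s ≠ 0 := fun h => by
        have := hmid s hs
        simp [h] at this
      have h1 := (((hd.hasDerivAt.sub_const (α.re : ℂ)).add
        (hasDerivAt_rootAlong hσ hα.2.1 hs hc)).const_mul (-Complex.I)).clog_real (hslit s hs')
      refine h1.congr_deriv ?_
      change -Complex.I * _ / (-Complex.I * u s) = _
      have hI : -Complex.I ≠ 0 := neg_ne_zero.mpr Complex.I_ne_zero
      rw [mul_div_mul_left _ _ hI, div_eq_iff hus]
      simp only [hu]
      field_simp
      ring)
    (continuousOn_const.div hRc fun s hs => rootAlong_ne_zero hσ hα.2.1 hs)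
  rw [radIntegral_eq_sub_conj γ σ α (k := fun _ => 1) (k' := fun _ => 1) (by simp), hFTC,
    Complex.sub_conj, Complex.sub_im, hv₀, hv₁, im_log_neg_I_mul hv₀0, im_log_neg_I_mul hv₁0,
    hs₀, hs₁]
  rcases hσ with rfl | rfl
  · rw [sign_neg (by simpa using hρ₁), sign_pos (by simpa using hρ₀)]
    simp
  · rw [sign_pos (by simpa using hρ₁), sign_neg (by simpa using hρ₀)]
    simp
    ring

/-- This is the differential equation `Q C' + Q' C / 2 = 0` for `C(z) = ∮ 1 / ((ζ - z) R)`. The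
combined integrand is the `ζ`-derivative of `-R / (ζ - z)`, as expanding `Q(ζ)` about `z` shows, and
the boundary values cancel by reality of `R₊` at the ends. -/
theorem radicand_mul_doubleCauchy {γ : SymmetricLoop} {σ : ℤ} (hσ : σ = 1 ∨ σ = -1) {α : ℂ}
    (hα : α ∈ encircled γ σ) {z : ℂ} (hz : z ∉ γ.trace) :
    radicand α z * doubleCauchy γ σ α (fun _ => 1) z z +
      (z - α.re) * cauchy γ σ α (fun _ => 1) z = 0 := by
  have hRc := continuousOn_rootAlong (γ := γ) σ hα.2.1
  set k : ℂ → ℂ → ℂ := fun z ζ =>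
    radicand α z * (1 * (1 / ((ζ - z) * (ζ - z)))) + (z - α.re) * (1 * (1 / (ζ - z))) with hk
  have hkcont : ∀ y ∉ γ.trace, ContinuousOn (k y) γ.trace := fun y hy =>
    (continuousOn_const.mul (continuousOn_const.mul (continuousOn_inv_sub_mul_sub hy hy))).add
      (continuousOn_const.mul (continuousOn_const.mul (continuousOn_inv_sub hy)))
  have key : ∀ y ∉ γ.trace,
      ∫ s in (0 : ℝ)..1, k y (γ.path s) / rootAlong γ σ α s * deriv γ.path s =
        -(rootAlong γ σ α 1 / (γ.path 1 - y)) - -(rootAlong γ σ α 0 / (γ.path 0 - y)) := by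
    intro y hy
    refine integral_eq_sub_along γ (G := fun s => -(rootAlong γ σ α s / (γ.path s - y)))
      (hRc.div (γ.continuousOn_path.sub continuousOn_const)
        fun s hs => sub_ne_of_mem_of_notMem (γ.path_mem hs) hy).neg
      (fun s hs hd hc => ?_)
      (((hkcont y hy).comp γ.continuousOn_path fun s hs => γ.path_mem hs).div hRc
        fun s hs => rootAlong_ne_zero hσ hα.2.1 hs)
    have hs' := Ioo_subset_Icc_self hs
    have hR := rootAlong_ne_zero hσ hα.2.1 hs'
    have hne := sub_ne_of_mem_of_notMem (γ.path_mem hs') hy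
    have hsq := rootAlong_sq hσ hα.2.1 hs'
    rw [radicand_eq] at hsq
    refine (((hasDerivAt_rootAlong hσ hα.2.1 hs hc).fun_div (hd.hasDerivAt.sub_const y)
      hne).fun_neg).congr_deriv ?_
    simp only [hk, radicand_eq]
    field_simp
    rw [hsq]
    ring
  have i1 := ((isSchwarz_one γ).radIntegrable hσ hα.2.1
    (continuousOn_inv_sub_mul_sub hz hz)).const_mul (radicand α z)
  have i2 := ((isSchwarz_one γ).radIntegrable hσ hα.2.1
    (continuousOn_inv_sub hz)).const_mul (z - α.re)
  rw [cauchy_eq_radIntegral, doubleCauchy, ← radIntegral_const_mul, ← radIntegral_const_mul,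
    ← radIntegral_add i1 i2]
  change radIntegral γ σ α (k z) = 0
  rw [radIntegral_eq_sub_conj γ σ α (k := k z) (k' := k (conj z)) fun ζ => by
      simp [hk, radicand_conj],
    key z hz, key _ (SymmetricLoop.conj_notMem_trace hz)]
  simp only [map_sub, map_neg, map_div₀, rootAlong_one_real hσ hα, rootAlong_zero_real,
    Complex.conj_conj, Complex.conj_eq_iff_im.mpr γ.start_real,
    Complex.conj_eq_iff_im.mpr γ.end_real]
  ring

theorem inside_subset {γ : SymmetricLoop} {α z : ℂ} (hz : z ∈ inside γ α) : z ∉ γ.trace := by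
  rcases hz with h | h <;> exact connectedComponentIn_subset _ _ h

theorem isOpen_inside (γ : SymmetricLoop) (α : ℂ) : IsOpen (inside γ α) :=
  γ.isOpen_compl_trace.connectedComponentIn.union γ.isOpen_compl_trace.connectedComponentIn

theorem mem_inside_self {γ : SymmetricLoop} {α : ℂ} (hα : α ∉ γ.trace) : α ∈ inside γ α :=
  Or.inl (mem_connectedComponentIn hα)

/-- `inside` depends on the branch point only through its component, which does not change under
small moves. Formulas valid inside can therefore be differentiated along a moving `α`. -/
theorem eventually_mem_inside {γ : SymmetricLoop} {α z : ℂ} (hα : α ∉ γ.trace)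
    (hz : z ∈ inside γ α) : ∀ᶠ a in 𝓝 α, z ∈ inside γ a := by
  rcases hz with h | h
  · have ho := γ.isOpen_compl_trace.connectedComponentIn (x := α)
    filter_upwards [ho.mem_nhds (mem_connectedComponentIn hα)] with a ha
    exact Or.inl (connectedComponentIn_eq ha ▸ h)
  · have ho := γ.isOpen_compl_trace.connectedComponentIn (x := conj α)
    have hc : ∀ᶠ a in 𝓝 α, conj a ∈ connectedComponentIn γ.traceᶜ (conj α) :=
      Complex.continuous_conj.continuousAt.eventually_mem
        (ho.mem_nhds (mem_connectedComponentIn (SymmetricLoop.conj_notMem_trace hα)))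
    filter_upwards [hc] with a ha
    exact Or.inr (connectedComponentIn_eq ha ▸ h)

/-- By the differential equation `Q C²` has derivative `0`; the square avoids choosing a branch of
`R` inside. It vanishes at `α` and at `ᾱ`, so `C = 0` on their components wherever `Q ≠ 0`. -/
theorem cauchy_one_eq_zero {γ : SymmetricLoop} {σ : ℤ} (hσ : σ = 1 ∨ σ = -1) {α : ℂ}
    (hα : α ∈ encircled γ σ) {z : ℂ} (hz : z ∈ inside γ α) :
    cauchy γ σ α (fun _ => 1) z = 0 := by
  have hb : (α.im : ℂ) ≠ 0 := by exact_mod_cast hα.1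
  have hconj : conj α - α.re = -(Complex.I * α.im) := by
    apply Complex.ext <;> simp
  have hself : α - α.re = Complex.I * α.im := by
    apply Complex.ext <;> simp
  -- At the zeros of `Q` the differential equation reduces to `Q' C = 0` with `Q' ≠ 0`.
  have hbase : ∀ β, β ∉ γ.trace → radicand α β = 0 → cauchy γ σ α (fun _ => 1) β = 0 := by
    intro β hβ h0
    have h := radicand_mul_doubleCauchy hσ hα hβ
    rw [h0, zero_mul, zero_add] at h
    refine (mul_eq_zero.mp h).resolve_left ?_
    rcases mul_eq_zero.mp h0 with h1 | h1
    · rw [sub_eq_zero.mp h1, hself]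
      exact mul_ne_zero Complex.I_ne_zero hb
    · rw [sub_eq_zero.mp h1, hconj]
      exact neg_ne_zero.mpr (mul_ne_zero Complex.I_ne_zero hb)
  by_cases hr : radicand α z = 0
  · exact hbase z (inside_subset hz) hr
  have hder : ∀ y ∉ γ.trace, HasDerivAt
      (fun y => radicand α y * cauchy γ σ α (fun _ => 1) y ^ 2) 0 y := by
    intro y hy
    have h1 : HasDerivAt (fun y => radicand α y) (2 * (y - α.re)) y := by
      simp only [radicand_eq]
      refine ((((hasDerivAt_id y).sub_const (α.re : ℂ)).pow 2).add_const _).congr_deriv ?_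
      simp
    have h2 := (isSchwarz_one γ).hasDerivAt_cauchy hσ hα.2.1 hy
    refine (h1.mul (h2.pow 2)).congr_deriv ?_
    have h3 := radicand_mul_doubleCauchy hσ hα hy
    simp only [Nat.add_one_sub_one, pow_one, Nat.cast_ofNat, Pi.pow_apply]
    linear_combination 2 * cauchy γ σ α (fun _ => 1) y * h3
  have hconst : ∀ β, β ∉ γ.trace → radicand α β = 0 → z ∈ connectedComponentIn γ.traceᶜ β →
      cauchy γ σ α (fun _ => 1) z = 0 := by
    intro β hβ h0 hzβ
    have hsub := connectedComponentIn_subset γ.traceᶜ β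
    have h := (γ.isOpen_compl_trace.connectedComponentIn (x := β)).is_const_of_deriv_eq_zero
      isPreconnected_connectedComponentIn
      (fun y hy => (hder y (hsub hy)).differentiableAt.differentiableWithinAt)
      (fun y hy => (hder y (hsub hy)).deriv) hzβ (mem_connectedComponentIn hβ)
    simp only [h0, zero_mul] at h
    exact pow_eq_zero_iff two_ne_zero |>.mp ((mul_eq_zero.mp h).resolve_left hr)
  rcases hz with h | h
  · exact hconst α hα.2.1 (by simp [radicand]) h
  · exact hconst (conj α) (SymmetricLoop.conj_notMem_trace hα.2.1) (by simp [radicand]) h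

/-- Use `ζ / (ζ - z) = 1 + z / (ζ - z)`; the last term integrates to `0` inside the loop. -/
theorem cauchy_id {γ : SymmetricLoop} {σ : ℤ} (hσ : σ = 1 ∨ σ = -1) {α : ℂ}
    (hα : α ∈ encircled γ σ) {z : ℂ} (hz : z ∈ inside γ α) :
    cauchy γ σ α (fun ζ => ζ) z = 2 * Real.pi * Complex.I * σ := by
  have hk := continuousOn_inv_sub (inside_subset hz)
  have i1 := ((isSchwarz_one γ).radIntegrable hσ hα.2.1 hk).const_mul z
  have i0 : RadIntegrable γ σ α (fun _ => 1) := by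
    simpa using (isSchwarz_one γ).radIntegrable (σ := σ) hσ hα.2.1 (k := fun _ => 1)
      continuousOn_const
  have h : cauchy γ σ α (fun ζ => ζ) z =
      radIntegral γ σ α (fun _ => 1) + z * cauchy γ σ α (fun _ => 1) z := by
    rw [cauchy_eq_radIntegral, cauchy_eq_radIntegral, ← radIntegral_const_mul,
      ← radIntegral_add i0 i1]
    refine radIntegral_congr fun ζ hζ => ?_
    have := sub_ne_of_mem_of_notMem hζ (inside_subset hz)
    field_simp
    ring
  rw [h, cauchy_one_eq_zero hσ hα hz, radIntegral_one hσ hα]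
  ring

/-- Use `ζ² / (ζ - z) = (ζ - Re α) + Re α + z ζ / (ζ - z)`. -/
theorem cauchy_sq {γ : SymmetricLoop} {σ : ℤ} (hσ : σ = 1 ∨ σ = -1) {α : ℂ}
    (hα : α ∈ encircled γ σ) {z : ℂ} (hz : z ∈ inside γ α) :
    cauchy γ σ α (fun ζ => ζ ^ 2) z = 2 * Real.pi * Complex.I * σ * (z + α.re) := by
  have hk := continuousOn_inv_sub (inside_subset hz)
  have i1 := ((isSchwarz_id γ).radIntegrable hσ hα.2.1 hk).const_mul z
  have i0 : RadIntegrable γ σ α (fun ζ => ζ - α.re) := by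
    simpa using (isSchwarz_one γ).radIntegrable (σ := σ) hσ hα.2.1 (k := fun ζ => ζ - α.re)
      (by fun_prop)
  have i2 : RadIntegrable γ σ α (fun _ => α.re * 1) := by
    simpa using (isSchwarz_one γ).radIntegrable (σ := σ) hσ hα.2.1 (k := fun _ => (α.re : ℂ))
      continuousOn_const
  have h : cauchy γ σ α (fun ζ => ζ ^ 2) z =
      radIntegral γ σ α (fun ζ => ζ - α.re) + α.re * radIntegral γ σ α (fun _ => 1) +
        z * cauchy γ σ α (fun ζ => ζ) z := by
    rw [cauchy_eq_radIntegral, cauchy_eq_radIntegral, ← radIntegral_const_mul,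
      ← radIntegral_const_mul, ← radIntegral_add i0 i2, ← radIntegral_add (i0.add i2) i1]
    refine radIntegral_congr fun ζ hζ => ?_
    have := sub_ne_of_mem_of_notMem hζ (inside_subset hz)
    field_simp
    ring
  rw [h, cauchy_id hσ hα hz, radIntegral_one hσ hα, radIntegral_sub_re hσ hα]
  ring

/-! ### The square root near a point -/

theorem sqrtNear_self {r : ℂ} (hr : r ≠ 0) : sqrtNear r (r ^ 2) = r := by
  rw [sqrtNear, div_self (pow_ne_zero 2 hr), Complex.one_cpow, mul_one]

theorem hasDerivAt_sqrtNear {r y : ℂ} (hr : r ≠ 0) (hy : r ^ 2 = y) :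
    HasDerivAt (sqrtNear r) (1 / (2 * r)) y := by
  have hr2 := pow_ne_zero 2 hr
  have h1 : HasDerivAt (fun y => y / r ^ 2) (1 / r ^ 2) y := (hasDerivAt_id y).div_const _
  have h2 := (h1.cpow_const (c := (1 / 2 : ℂ)) (by simp [← hy, div_self hr2])).const_mul r
  refine h2.congr_deriv ?_
  rw [← hy, div_self hr2, Complex.one_cpow]
  field_simp

theorem sub_ne_zero_of_sq_eq {α z r : ℂ} (hr : r ^ 2 = radicand α z) (hr0 : r ≠ 0) :
    z - α ≠ 0 ∧ z - conj α ≠ 0 := by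
  have h := pow_ne_zero 2 hr0
  rw [hr, radicand] at h
  exact mul_ne_zero_iff.mp h

theorem hasFDerivAt_sqrtNear_radicand {α z r : ℂ} (hr : r ^ 2 = radicand α z) (hr0 : r ≠ 0) :
    HasFDerivAt (fun a => sqrtNear r (radicand a z))
      (wirtingerCLM (-(r / (2 * (z - α)))) (-(r / (2 * (z - conj α))))) α := by
  obtain ⟨n1, n2⟩ := sub_ne_zero_of_sq_eq hr hr0
  have h1 := (hasFDerivAt_wirtingerCLM_const z α).sub_wirtinger (hasFDerivAt_wirtingerCLM_id α)
  have h2 := (hasFDerivAt_wirtingerCLM_const z α).sub_wirtinger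
    (hasFDerivAt_wirtingerCLM_id α).conj_wirtinger
  have h3 := ((hasDerivAt_sqrtNear hr0 hr).hasFDerivAt.restrictScalars ℝ).comp α
    (h1.mul_wirtinger h2)
  refine h3.congr_fderiv ?_
  rw [radicand] at hr
  have e1 : r / (2 * (z - α)) = (z - conj α) / (2 * r) := by
    field_simp; rw [hr]
  have e2 : r / (2 * (z - conj α)) = (z - α) / (2 * r) := by
    field_simp; rw [hr]; ring
  rw [e1, e2]
  ext v
  simp
  ring

theorem hasDerivAt_sqrtNear_radicand {α z r : ℂ} (hr : r ^ 2 = radicand α z) (hr0 : r ≠ 0) :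
    HasDerivAt (fun y => sqrtNear r (radicand α y)) ((z - α.re) / r) z := by
  have h1 : HasDerivAt (fun y => radicand α y) (2 * (z - α.re)) z := by
    simp only [radicand_eq]
    refine ((((hasDerivAt_id z).sub_const (α.re : ℂ)).pow 2).add_const _).congr_deriv ?_
    simp
  refine (HasDerivAt.comp z (hasDerivAt_sqrtNear hr0 hr) h1).congr_deriv ?_
  field_simp

/-! ### The modulation equation and the function `h` -/

theorem sign_sq {σ : ℤ} (hσ : σ = 1 ∨ σ = -1) : (σ : ℂ) ^ 2 = 1 := by
  rcases hσ with rfl | rfl <;> norm_num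

/-- In this form `V` is the value at `z = α` of the factor `z + Re α` in `h_t`, which is how it
enters the hodograph equation. -/
theorem V_eq (α : ℂ) : V α = α + α.re := by
  have h := add_conj_eq α
  rw [V]
  linear_combination h / 2

theorem V_sub_conj (α : ℂ) : V α - conj (V α) = α - conj α := by
  rw [V_eq]; simp

theorem two_pi_I_ne : (2 * Real.pi * Complex.I : ℂ) ≠ 0 := by
  simp [Real.pi_ne_zero, Complex.I_ne_zero]

section

variable {γ : SymmetricLoop} {σ : ℤ} {f₀ : ℂ → ℂ}

/-- `∂_α R = -R / (2 (z - α))` multiplies `C(z)`, while `∂_α C(z)` is `(C(α) - C(z)) / (2 (α - z))`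
by partial fractions. The terms with `C(z)` cancel and only `C(α)` survives. -/
theorem hasFDerivAt_h (hf : γ.IsSchwarz f₀) (hσ : σ = 1 ∨ σ = -1) {α z r : ℂ}
    (hα : α ∉ γ.trace) (hz : z ∉ γ.trace) (hr : r ^ 2 = radicand α z) (hr0 : r ≠ 0) (x t : ℝ) :
    HasFDerivAt (fun a => h γ σ f₀ z (sqrtNear r (radicand a z)) x t a)
      (wirtingerCLM
        (-(r / (2 * (z - α))) * (1 / (2 * Real.pi * Complex.I) * cauchy γ σ α (phase f₀ x t) α))
        (-(r / (2 * (z - conj α))) *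
          (1 / (2 * Real.pi * Complex.I) * cauchy γ σ α (phase f₀ x t) (conj α)))) α := by
  obtain ⟨n1, n2⟩ := sub_ne_zero_of_sq_eq hr hr0
  have hα' := SymmetricLoop.conj_notMem_trace hα
  have hp := hf.phase x t
  have h1 := hp.hasFDerivAt_cauchy (σ := σ) hσ hα (hasFDerivAt_wirtingerCLM_const z α) hz
  have h2 := ((hasFDerivAt_sqrtNear_radicand hr hr0).mul_wirtinger h1).const_mul_wirtinger
    (1 / (2 * Real.pi * Complex.I))
  have p1 := hp.sub_mul_doubleCauchy (σ := σ) hσ hα hα hz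
  have p2 := hp.sub_mul_doubleCauchy (σ := σ) hσ hα hα' hz
  have m1 : α - z ≠ 0 := by rw [← neg_sub]; exact neg_ne_zero.mpr n1
  have m2 : conj α - z ≠ 0 := by rw [← neg_sub]; exact neg_ne_zero.mpr n2
  have q1 := eq_div_of_mul_eq m1 ((mul_comm _ _).trans p1)
  have q2 := eq_div_of_mul_eq m2 ((mul_comm _ _).trans p2)
  refine (h2.congr_fderiv ?_).congr_of_eventuallyEq (Eventually.of_forall fun a => ?_)
  · rw [q1, q2, ← hr, sqrtNear_self hr0, ← neg_sub z α, ← neg_sub z (conj α)]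
    congr 1
    · field_simp
      ring
    · field_simp
      ring
  · simp only [h]
    ring

theorem cauchy_phase_eq (hf : γ.IsSchwarz f₀) (hσ : σ = 1 ∨ σ = -1) {α z : ℂ}
    (hα : α ∈ encircled γ σ) (hz : z ∈ inside γ α) (x t : ℝ) :
    cauchy γ σ α (phase f₀ x t) z = cauchy γ σ α f₀ z +
      4 * Real.pi * Complex.I * σ * (x + (z + α.re) * t) := by
  rw [hf.cauchy_phase hσ hα.2.1 (inside_subset hz), cauchy_id hσ hα hz, cauchy_sq hσ hα hz]
  ring

theorem modulationEq_iff (hf : γ.IsSchwarz f₀) (hσ : σ = 1 ∨ σ = -1) {α : ℂ}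
    (hα : α ∈ encircled γ σ) (x t : ℝ) :
    ModulationEq γ σ f₀ x t α ↔ (x : ℂ) + V α * t = w γ σ f₀ α := by
  have hs := sign_sq hσ
  have hpi := two_pi_I_ne
  have hc : (4 * Real.pi * Complex.I : ℂ) ≠ 0 := by
    have : (4 * Real.pi * Complex.I : ℂ) = 2 * (2 * Real.pi * Complex.I) := by ring
    rw [this]; exact mul_ne_zero two_ne_zero hpi
  have hσ0 : (σ : ℂ) ≠ 0 := fun h0 => by simp [h0] at hs
  have hw : cauchy γ σ α f₀ α = -(4 * Real.pi * Complex.I * σ) * w γ σ f₀ α := by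
    rw [w]
    field_simp
    rw [hs, mul_one]
  have hkey : cauchy γ σ α (phase f₀ x t) α =
      4 * Real.pi * Complex.I * σ * ((x : ℂ) + V α * t - w γ σ f₀ α) := by
    rw [cauchy_phase_eq hf hσ hα (mem_inside_self hα.2.1), hw, V_eq]
    ring
  rw [ModulationEq, hkey, mul_eq_zero, or_iff_right (mul_ne_zero hc hσ0), sub_eq_zero]

theorem modulationEq_iff_conj (hf : γ.IsSchwarz f₀) (x t : ℝ) (α : ℂ) :
    ModulationEq γ σ f₀ x t α ↔ ModulationEqConj γ σ f₀ x t α := by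
  rw [ModulationEq, ModulationEqConj, (hf.phase x t).cauchy_conj]
  simp

theorem modulationEqConj_iff (hf : γ.IsSchwarz f₀) (hσ : σ = 1 ∨ σ = -1) {α : ℂ}
    (hα : α ∈ encircled γ σ) (x t : ℝ) :
    ModulationEqConj γ σ f₀ x t α ↔ (x : ℂ) + conj (V α) * t = conj (w γ σ f₀ α) := by
  rw [← modulationEq_iff_conj hf, modulationEq_iff hf hσ hα,
    ← (starRingEnd ℂ).injective.eq_iff (a := (x : ℂ) + V α * t)]
  simp

/-! ### The Tsarev equation -/

theorem hasFDerivAt_V (α : ℂ) : HasFDerivAt V (wirtingerCLM (3 / 2) (1 / 2)) α := by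
  have h := ((hasFDerivAt_wirtingerCLM_id α).const_mul (3 / 2 : ℂ)).add
    ((hasFDerivAt_wirtingerCLM_id α).conj_wirtinger.const_mul (1 / 2 : ℂ))
  refine h.congr_fderiv ?_
  ext v
  simp

/-- The pole `ζ = α` does not depend on `ᾱ`, so only `1 / R` contributes to `∂_ᾱ w`. Partial
fractions give `C(ᾱ) - C(α)` with `C(ᾱ) = -conj C(α)`, and the imaginary prefactor turns this into
`w - w̄`. The value of `∂_α w` is never needed. -/
theorem hasFDerivAt_w (hf : γ.IsSchwarz f₀) (hσ : σ = 1 ∨ σ = -1) {α : ℂ} (hα0 : α.im ≠ 0)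
    (hα : α ∉ γ.trace) :
    ∃ w₁ : ℂ, HasFDerivAt (w γ σ f₀) (wirtingerCLM w₁
      (1 / 2 * ((w γ σ f₀ α - conj (w γ σ f₀ α)) / (α - conj α)))) α := by
  have hα' := SymmetricLoop.conj_notMem_trace hα
  have h1 := (hf.hasFDerivAt_cauchy (σ := σ) hσ hα (hasFDerivAt_wirtingerCLM_id α)
    hα).const_mul_wirtinger (-(σ : ℂ) / (4 * Real.pi * Complex.I))
  refine ⟨-(σ : ℂ) / (4 * Real.pi * Complex.I) * (1 / 2 * doubleCauchy γ σ α f₀ α α +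
    1 * doubleCauchy γ σ α f₀ α α), h1.congr_fderiv ?_⟩
  have hne := sub_conj_ne_zero hα0
  have p := hf.sub_mul_doubleCauchy (σ := σ) hσ hα hα' hα
  rw [hf.cauchy_conj] at p
  have hne' : conj α - α ≠ 0 := by rw [← neg_sub]; exact neg_ne_zero.mpr hne
  rw [eq_div_of_mul_eq hne' ((mul_comm _ _).trans p), zero_mul, add_zero, ← neg_sub α (conj α)]
  congr 1
  simp only [w, map_mul, map_div₀, map_neg, Complex.conj_I, Complex.conj_ofReal,
    map_ofNat (starRingEnd ℂ) 4, map_intCast]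
  field_simp
  ring

/-- Here `∂_ᾱ V = 1/2` and `V - V̄ = α - ᾱ`, so the assumed `ᾱ`-derivative is exactly the Tsarev
equation. -/
theorem isTsarevAt_of_hasFDerivAt {W : ℂ → ℂ} {α w₁ : ℂ} (hα : α.im ≠ 0)
    (hW : HasFDerivAt W (wirtingerCLM w₁ (1 / 2 * ((W α - conj (W α)) / (α - conj α)))) α) :
    IsTsarevAt V W α := by
  have hne := sub_conj_ne_zero hα
  have hV := hasFDerivAt_V α
  have e1 : wirtingerBar W α * (V α - conj (V α)) =
      wirtingerBar V α * (W α - conj (W α)) := by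
    rw [wirtingerBar_eq hW, wirtingerBar_eq hV, V_sub_conj]
    field_simp
  have hne2 : conj (V α) - V α ≠ 0 := by
    rw [← neg_sub, V_sub_conj]; exact neg_ne_zero.mpr hne
  have e2 : wirtinger (fun a => conj (W a)) α * (conj (V α) - V α) =
      wirtinger (fun a => conj (V a)) α * (conj (W α) - W α) := by
    rw [wirtinger_eq hW.conj_wirtinger, wirtinger_eq hV.conj_wirtinger]
    have := congrArg conj e1
    rw [wirtingerBar_eq hW, wirtingerBar_eq hV] at this
    simpa only [map_mul, map_sub, Complex.conj_conj] using this
  refine ⟨hV.differentiableAt, hW.differentiableAt, ?_, e1, e2, fun hw => ⟨?_, ?_⟩⟩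
  · rw [← sub_ne_zero, V_sub_conj]; exact hne
  · rw [div_eq_div_iff (sub_ne_zero.mpr hw) (by rwa [V_sub_conj]), e1]
  · rw [div_eq_div_iff (sub_ne_zero.mpr (Ne.symm hw)) hne2, e2]

/-! ### Functions of `x` and `t` -/

theorem hasDerivAt_fst_slice {E : Type*} [NormedAddCommGroup E] [NormedSpace ℝ E] {α : ℝ × ℝ → E}
    {x t : ℝ} (hd : DifferentiableAt ℝ α (x, t)) :
    HasDerivAt (fun x' => α (x', t)) (fderiv ℝ α (x, t) (1, 0)) x :=
  HasFDerivAt.comp_hasDerivAt (l := α) x hd.hasFDerivAt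
    ((hasDerivAt_id x).prodMk (hasDerivAt_const x t))

theorem hasDerivAt_snd_slice {E : Type*} [NormedAddCommGroup E] [NormedSpace ℝ E] {α : ℝ × ℝ → E}
    {x t : ℝ} (hd : DifferentiableAt ℝ α (x, t)) :
    HasDerivAt (fun t' => α (x, t')) (fderiv ℝ α (x, t) (0, 1)) t :=
  HasFDerivAt.comp_hasDerivAt (l := α) t hd.hasFDerivAt
    ((hasDerivAt_const t x).prodMk (hasDerivAt_id t))

theorem HasFDerivAt.comp_wirtinger {g : ℂ → ℂ} {β : ℝ → ℂ} {p q β' : ℂ} {s : ℝ}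
    (hg : HasFDerivAt g (wirtingerCLM p q) (β s)) (hβ : HasDerivAt β β' s) :
    HasDerivAt (fun s => g (β s)) (p * β' + q * conj β') s :=
  (hg.comp_hasDerivAt s hβ).congr_deriv (by simp)

theorem eventually_fst_mem {D : Set (ℝ × ℝ)} (hD : IsOpen D) {x t : ℝ} (hp : (x, t) ∈ D) :
    ∀ᶠ x' in 𝓝 x, (x', t) ∈ D :=
  (Continuous.prodMk_left t).continuousAt.eventually_mem (hD.mem_nhds hp)

theorem eventually_snd_mem {D : Set (ℝ × ℝ)} (hD : IsOpen D) {x t : ℝ} (hp : (x, t) ∈ D) :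
    ∀ᶠ t' in 𝓝 t, (x, t') ∈ D :=
  (Continuous.prodMk_right x).continuousAt.eventually_mem (hD.mem_nhds hp)

theorem fderiv_conj_apply {α : ℝ × ℝ → ℂ} {p : ℝ × ℝ} (hd : DifferentiableAt ℝ α p) (v : ℝ × ℝ) :
    fderiv ℝ (fun q => conj (α q)) p v = conj (fderiv ℝ α p v) := by
  have h1 : HasFDerivAt (fun q => conj (α q)) _ p :=
    (Complex.conjCLE.toContinuousLinearMap.hasFDerivAt (x := α p)).comp p hd.hasFDerivAt
  rw [h1.fderiv]
  simp

theorem solvesWhitham_iff {D : Set (ℝ × ℝ)} (hD : IsOpen D) {α : ℝ × ℝ → ℂ}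
    (hd : DifferentiableOn ℝ α D) :
    SolvesWhitham D α ↔
      ∀ p ∈ D, fderiv ℝ α p (0, 1) = V (α p) * fderiv ℝ α p (1, 0) := by
  refine ⟨fun hW p hp => (hW p hp).1, fun hW p hp => ⟨hW p hp, ?_⟩⟩
  have hdp := hd.differentiableAt (hD.mem_nhds hp)
  rw [fderiv_conj_apply hdp, fderiv_conj_apply hdp, hW p hp, map_mul]

/-- Differentiating the hodograph equation gives the Whitham system. -/
theorem solvesWhitham_of_modulationEq (hf : γ.IsSchwarz f₀) (hσ : σ = 1 ∨ σ = -1)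
    {D : Set (ℝ × ℝ)} {α : ℝ × ℝ → ℂ} (hD : IsOpen D) (hd : DifferentiableOn ℝ α D)
    (hα : ∀ p ∈ D, α p ∈ encircled γ σ ∧ ModulationEq γ σ f₀ p.1 p.2 (α p)) :
    SolvesWhitham D α := by
  rw [solvesWhitham_iff hD hd]
  rintro ⟨x, t⟩ hp
  have hdp := hd.differentiableAt (hD.mem_nhds hp)
  have hodo : ∀ p ∈ D, ((p.1 : ℂ) + V (α p) * p.2) - w γ σ f₀ (α p) = 0 := fun p hp =>
    sub_eq_zero.mpr ((modulationEq_iff hf hσ (hα p hp).1 _ _).mp (hα p hp).2)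
  have hne := sub_conj_ne_zero (hα _ hp).1.1
  obtain ⟨w₁, hw⟩ := hasFDerivAt_w hf hσ (hα _ hp).1.1 (hα _ hp).1.2.1
  -- Subtracting the conjugate hodograph equation gives `(α - ᾱ) t = w - w̄`. Hence `∂_ᾱ w = t / 2 =
  -- t ∂_ᾱ V`, and the `ᾱ` terms below cancel.
  have hw₂ : (w γ σ f₀ (α (x, t)) - conj (w γ σ f₀ (α (x, t)))) / (α (x, t) - conj (α (x, t))) =
      t := by
    have h1 := sub_eq_zero.mp (hodo _ hp)
    rw [← h1, div_eq_iff hne]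
    simp only [map_add, map_mul, Complex.conj_ofReal]
    linear_combination t * V_sub_conj (α (x, t))
  rw [hw₂] at hw
  have hV := hasFDerivAt_V (α (x, t))
  have cx := hasDerivAt_fst_slice hdp
  have ct := hasDerivAt_snd_slice hdp
  set ax := fderiv ℝ α (x, t) (1, 0)
  set at' := fderiv ℝ α (x, t) (0, 1)
  have dx : HasDerivAt (fun x' : ℝ => ((x' : ℂ) + V (α (x', t)) * t) - w γ σ f₀ (α (x', t)))
      (1 + (3 / 2 * ax + 1 / 2 * conj ax) * t - (w₁ * ax + 1 / 2 * t * conj ax)) x :=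
    ((Complex.ofRealCLM.hasDerivAt (x := x)).add
      ((HasFDerivAt.comp_wirtinger (β := fun x' => α (x', t)) hV cx).mul_const (t : ℂ))).sub
      (HasFDerivAt.comp_wirtinger (β := fun x' => α (x', t)) hw cx)
  have dt : HasDerivAt (fun t' : ℝ => ((x : ℂ) + V (α (x, t')) * t') - w γ σ f₀ (α (x, t')))
      (((3 / 2 * at' + 1 / 2 * conj at') * t + V (α (x, t)) * 1) -
        (w₁ * at' + 1 / 2 * t * conj at')) t :=
    (((HasFDerivAt.comp_wirtinger (β := fun t' => α (x, t')) hV ct).mul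
      (Complex.ofRealCLM.hasDerivAt (x := t))).const_add (x : ℂ)).sub
      (HasFDerivAt.comp_wirtinger (β := fun t' => α (x, t')) hw ct)
  have zx := dx.unique ((hasDerivAt_const x (0 : ℂ)).congr_of_eventuallyEq (by
    filter_upwards [eventually_fst_mem hD hp] with x' hx'
    exact hodo _ hx'))
  have zt := dt.unique ((hasDerivAt_const t (0 : ℂ)).congr_of_eventuallyEq (by
    filter_upwards [eventually_snd_mem hD hp] with t' ht'
    exact hodo _ ht'))
  -- The two differentiated equations read `(w₁ - 3t/2) α_x = 1` and `(w₁ - 3t/2) α_t = V`; the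
  -- first forces the factor to be nonzero.
  have hc : w₁ - 3 / 2 * t ≠ 0 := by
    intro h0
    have : (1 : ℂ) = 0 := by linear_combination zx + ax * h0
    exact one_ne_zero this
  refine mul_left_cancel₀ hc ?_
  linear_combination V (α (x, t)) * zx - zt

/-! ### The derivatives of `h` -/

theorem h_eq (hf : γ.IsSchwarz f₀) (hσ : σ = 1 ∨ σ = -1) {α z : ℂ} (hα : α ∈ encircled γ σ)
    (hz : z ∈ inside γ α) (r : ℂ) (x t : ℝ) :
    h γ σ f₀ z r x t α =
      x * (2 * σ * r) + t * (2 * σ * (z + α.re) * r) + h₀ γ σ f₀ z r α := by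
  have := two_pi_I_ne
  rw [h, h₀, cauchy_phase_eq hf hσ hα hz]
  field_simp
  ring

theorem hasDerivAt_h_x (hf : γ.IsSchwarz f₀) (hσ : σ = 1 ∨ σ = -1) {α z : ℂ}
    (hα : α ∈ encircled γ σ) (hz : z ∈ inside γ α) (r : ℂ) (x t : ℝ) :
    HasDerivAt (fun x' : ℝ => h γ σ f₀ z r x' t α) (2 * σ * r) x := by
  simp only [h_eq hf hσ hα hz]
  refine ((((Complex.ofRealCLM.hasDerivAt (x := x)).mul_const (2 * σ * r)).add_const
    _).add_const _).congr_deriv ?_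
  simp

theorem hasDerivAt_h_t (hf : γ.IsSchwarz f₀) (hσ : σ = 1 ∨ σ = -1) {α z : ℂ}
    (hα : α ∈ encircled γ σ) (hz : z ∈ inside γ α) (r : ℂ) (x t : ℝ) :
    HasDerivAt (fun t' : ℝ => h γ σ f₀ z r x t' α) (2 * σ * (z + α.re) * r) t := by
  simp only [h_eq hf hσ hα hz]
  refine ((((Complex.ofRealCLM.hasDerivAt (x := t)).mul_const
    (2 * σ * (z + α.re) * r)).const_add _).add_const _).congr_deriv ?_
  simp

theorem hx_eq (hf : γ.IsSchwarz f₀) (hσ : σ = 1 ∨ σ = -1) {α z : ℂ}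
    (hα : α ∈ encircled γ σ) (hz : z ∈ inside γ α) (r : ℂ) (x t : ℝ) :
    hx γ σ f₀ z r x t α = 2 * σ * r :=
  (hasDerivAt_h_x hf hσ hα hz r x t).deriv

theorem ht_eq (hf : γ.IsSchwarz f₀) (hσ : σ = 1 ∨ σ = -1) {α z : ℂ}
    (hα : α ∈ encircled γ σ) (hz : z ∈ inside γ α) (r : ℂ) (x t : ℝ) :
    ht γ σ f₀ z r x t α = 2 * σ * (z + α.re) * r :=
  (hasDerivAt_h_t hf hσ hα hz r x t).deriv

/-- A nonempty open set is infinite, so the branch points and any finite `S` can be avoided. `S`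
serves to produce a second point distinct from the first. -/
theorem exists_inside_sq_eq {α β : ℂ} (hβ : β ∈ inside γ α) (S : Finset ℂ) :
    ∃ z ∈ inside γ α, z ∉ S ∧ ∃ r : ℂ, r ^ 2 = radicand α z ∧ r ≠ 0 := by
  have hfin : (S ∪ {α, conj α} : Set ℂ).Finite := S.finite_toSet.union (by simp)
  obtain ⟨z, hz, hzS⟩ := ((infinite_of_mem_nhds β ((isOpen_inside γ α).mem_nhds hβ)).sdiff
    hfin).nonempty
  simp only [mem_union, mem_insert_iff, mem_singleton_iff, not_or] at hzS
  obtain ⟨r, hr⟩ := IsAlgClosed.exists_pow_nat_eq (radicand α z) two_pos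
  refine ⟨z, hz, hzS.1, r, hr, ?_⟩
  rintro rfl
  refine radicand_ne_zero (sub_ne_zero.mpr hzS.2.1) (sub_ne_zero.mpr hzS.2.2) ?_
  rw [← hr]; simp

end

/-! ### Stationarity of `h` in the branch points and its consequences along solutions -/

section

variable {γ : SymmetricLoop} {σ : ℤ} {f₀ : ℂ → ℂ}

theorem wirtinger_h_eq_zero_iff (hf : γ.IsSchwarz f₀) (hσ : σ = 1 ∨ σ = -1) {α : ℂ}
    (hα : α ∉ γ.trace) (x t : ℝ) :
    (∀ z ∈ inside γ α, ∀ r : ℂ, r ^ 2 = radicand α z → r ≠ 0 →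
      wirtinger (fun a => h γ σ f₀ z (sqrtNear r (radicand a z)) x t a) α = 0) ↔
        ModulationEq γ σ f₀ x t α := by
  refine ⟨fun H => ?_, fun H z hz r hr hr0 => ?_⟩
  · obtain ⟨z, hz, -, r, hr, hr0⟩ := exists_inside_sq_eq (mem_inside_self hα) ∅
    have h1 := H z hz r hr hr0
    rw [wirtinger_eq (hasFDerivAt_h hf hσ hα (inside_subset hz) hr hr0 x t)] at h1
    have n1 := (sub_ne_zero_of_sq_eq hr hr0).1
    have := two_pi_I_ne
    refine (mul_eq_zero.mp ((mul_eq_zero.mp h1).resolve_left ?_)).resolve_left ?_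
    · exact neg_ne_zero.mpr (div_ne_zero hr0 (mul_ne_zero two_ne_zero n1))
    · exact one_div_ne_zero this
  · rw [wirtinger_eq (hasFDerivAt_h hf hσ hα (inside_subset hz) hr hr0 x t)]
    rw [ModulationEq] at H
    rw [H]; ring

theorem wirtingerBar_h_eq_zero_iff (hf : γ.IsSchwarz f₀) (hσ : σ = 1 ∨ σ = -1) {α : ℂ}
    (hα : α ∉ γ.trace) (x t : ℝ) :
    (∀ z ∈ inside γ α, ∀ r : ℂ, r ^ 2 = radicand α z → r ≠ 0 →
      wirtingerBar (fun a => h γ σ f₀ z (sqrtNear r (radicand a z)) x t a) α = 0) ↔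
        ModulationEqConj γ σ f₀ x t α := by
  refine ⟨fun H => ?_, fun H z hz r hr hr0 => ?_⟩
  · obtain ⟨z, hz, -, r, hr, hr0⟩ := exists_inside_sq_eq (mem_inside_self hα) ∅
    have h1 := H z hz r hr hr0
    rw [wirtingerBar_eq (hasFDerivAt_h hf hσ hα (inside_subset hz) hr hr0 x t)] at h1
    have n1 := (sub_ne_zero_of_sq_eq hr hr0).2
    have := two_pi_I_ne
    refine (mul_eq_zero.mp ((mul_eq_zero.mp h1).resolve_left ?_)).resolve_left ?_
    · exact neg_ne_zero.mpr (div_ne_zero hr0 (mul_ne_zero two_ne_zero n1))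
    · exact one_div_ne_zero this
  · rw [wirtingerBar_eq (hasFDerivAt_h hf hσ hα (inside_subset hz) hr hr0 x t)]
    rw [ModulationEqConj] at H
    rw [H]; ring

/-- If `h` is stationary in `α`, `ᾱ`, its full derivative along a curve `α(s)` is the partial one. -/
theorem hasDerivAt_add_mul_of_stationary {g : ℂ → ℂ} {k : ℝ → ℂ} {β : ℝ → ℂ} {β' : ℂ} {s : ℝ}
    (hg : HasFDerivAt g (wirtingerCLM 0 0) (β s)) (hβ : HasDerivAt β β' s)
    (hk : ContinuousAt k s) : HasDerivAt (fun s' => g (β s') + (s' - s) * k s') (k s) s := by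
  have h1 := HasFDerivAt.comp_wirtinger hg hβ
  -- The difference quotient at `s` is exactly `k s'`, so continuity of `k` is enough.
  have h2 : HasDerivAt (fun s' : ℝ => ((s' : ℂ) - s) * k s') (k s) s := by
    rw [hasDerivAt_iff_tendsto_slope]
    refine (hk.tendsto.mono_left nhdsWithin_le_nhds).congr' ?_
    filter_upwards [self_mem_nhdsWithin] with s' hs'
    have hne : ((s' : ℂ) - s) ≠ 0 := by
      rw [← Complex.ofReal_sub]; exact_mod_cast sub_ne_zero.mpr hs'
    rw [slope_def_module, Complex.real_smul]
    push_cast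
    field_simp
    simp
  refine (h1.add h2).congr_deriv ?_
  simp

theorem hasDerivAt_h_along (hf : γ.IsSchwarz f₀) (hσ : σ = 1 ∨ σ = -1) {D : Set (ℝ × ℝ)}
    {α : ℝ × ℝ → ℂ} (hD : IsOpen D) (hd : DifferentiableOn ℝ α D)
    (hα : ∀ p ∈ D, α p ∈ encircled γ σ ∧ ModulationEq γ σ f₀ p.1 p.2 (α p))
    {x t : ℝ} (hp : (x, t) ∈ D) {z r : ℂ} (hz : z ∈ inside γ (α (x, t)))
    (hr : r ^ 2 = radicand (α (x, t)) z) (hr0 : r ≠ 0) :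
    HasDerivAt (fun x' : ℝ => h γ σ f₀ z (sqrtNear r (radicand (α (x', t)) z)) x' t (α (x', t)))
      (2 * σ * r) x ∧
    HasDerivAt (fun t' : ℝ => h γ σ f₀ z (sqrtNear r (radicand (α (x, t')) z)) x t' (α (x, t')))
      (2 * σ * (z + (α (x, t)).re) * r) t := by
  have hdp := hd.differentiableAt (hD.mem_nhds hp)
  obtain ⟨hA, hM⟩ := hα _ hp
  have hst := hasFDerivAt_h hf hσ hA.2.1 (inside_subset hz) hr hr0 x t
  have hM' := (modulationEq_iff_conj hf x t _).mp hM
  rw [ModulationEq] at hM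
  rw [ModulationEqConj] at hM'
  simp only at hM hM'
  rw [hM, hM', mul_zero, mul_zero, mul_zero] at hst
  have hroot := (hasFDerivAt_sqrtNear_radicand hr hr0).continuousAt
  have hself : sqrtNear r (radicand (α (x, t)) z) = r := by rw [← hr, sqrtNear_self hr0]
  have cx := hasDerivAt_fst_slice hdp
  have ct := hasDerivAt_snd_slice hdp
  have hre : Continuous fun a : ℂ => (a.re : ℂ) := by fun_prop
  constructor
  · have h1 := hasDerivAt_add_mul_of_stationary (β := fun x' => α (x', t))
      (k := fun x' => 2 * σ * sqrtNear r (radicand (α (x', t)) z)) hst cx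
      (continuousAt_const.mul (ContinuousAt.comp (f := fun x' => α (x', t)) hroot cx.continuousAt))
    refine (h1.congr_deriv (by simp only [hself])).congr_of_eventuallyEq ?_
    have hev := cx.continuousAt.eventually (eventually_mem_inside hA.2.1 hz)
    filter_upwards [eventually_fst_mem hD hp, hev] with x' hx' hx''
    -- `h` is affine in `x`: at the moved branch point, `h` at `x'` is `h` at `x` plus `(x' - x)
    -- h_x`. The first summand is stationary.
    rw [h_eq hf hσ (hα _ hx').1 hx'', h_eq hf hσ (hα _ hx').1 hx'']
    ring
  · have h1 := hasDerivAt_add_mul_of_stationary (β := fun t' => α (x, t'))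
      (k := fun t' => 2 * σ * (z + (α (x, t')).re) * sqrtNear r (radicand (α (x, t')) z)) hst ct
      ((continuousAt_const.mul (continuousAt_const.add
        (ContinuousAt.comp (f := fun t' => α (x, t')) hre.continuousAt ct.continuousAt))).mul
        (ContinuousAt.comp (f := fun t' => α (x, t')) hroot ct.continuousAt))
    refine (h1.congr_deriv (by simp only [hself])).congr_of_eventuallyEq ?_
    have hev := ct.continuousAt.eventually (eventually_mem_inside hA.2.1 hz)
    filter_upwards [eventually_snd_mem hD hp, hev] with t' ht' ht''
    rw [h_eq hf hσ (hα _ ht').1 ht'', h_eq hf hσ (hα _ ht').1 ht'']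
    ring

/-! ### Compatibility of `h_x` and `h_t` and the Whitham system -/

theorem hasFDerivAt_re (α : ℂ) :
    HasFDerivAt (fun a : ℂ => (a.re : ℂ)) (wirtingerCLM (1 / 2) (1 / 2)) α := by
  refine ((Complex.ofRealCLM.comp Complex.reCLM).hasFDerivAt (x := α)).congr_fderiv ?_
  ext v
  have := add_conj_eq v
  simp
  linear_combination -this / 2

/-- The derivatives `∂_x h_t` and `∂_t h_x` along a differentiable family `α(x, t)`. -/
theorem hasDerivAt_ht_hx_along (hf : γ.IsSchwarz f₀) (hσ : σ = 1 ∨ σ = -1) {D : Set (ℝ × ℝ)}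
    {α : ℝ × ℝ → ℂ} (hD : IsOpen D) (hd : DifferentiableOn ℝ α D)
    (hα : ∀ p ∈ D, α p ∈ encircled γ σ) {x t : ℝ} (hp : (x, t) ∈ D) {z r : ℂ}
    (hz : z ∈ inside γ (α (x, t))) (hr : r ^ 2 = radicand (α (x, t)) z) (hr0 : r ≠ 0) :
    HasDerivAt (fun x' : ℝ =>
        ht γ σ f₀ z (sqrtNear r (radicand (α (x', t)) z)) x' t (α (x', t)))
      (-(σ * r) * (V (α (x, t)) * fderiv ℝ α (x, t) (1, 0) / (z - α (x, t)) +
        conj (V (α (x, t)) * fderiv ℝ α (x, t) (1, 0)) / (z - conj (α (x, t))))) x ∧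
    HasDerivAt (fun t' : ℝ =>
        hx γ σ f₀ z (sqrtNear r (radicand (α (x, t')) z)) x t' (α (x, t')))
      (-(σ * r) * (fderiv ℝ α (x, t) (0, 1) / (z - α (x, t)) +
        conj (fderiv ℝ α (x, t) (0, 1)) / (z - conj (α (x, t))))) t := by
  have hdp := hd.differentiableAt (hD.mem_nhds hp)
  have hA := hα _ hp
  obtain ⟨n1, n2⟩ := sub_ne_zero_of_sq_eq hr hr0
  have hself : sqrtNear r (radicand (α (x, t)) z) = r := by rw [← hr, sqrtNear_self hr0]
  have cx := hasDerivAt_fst_slice hdp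
  have ct := hasDerivAt_snd_slice hdp
  have hroot := hasFDerivAt_sqrtNear_radicand hr hr0
  set ax := fderiv ℝ α (x, t) (1, 0)
  set at' := fderiv ℝ α (x, t) (0, 1)
  constructor
  · have h1 := ((HasFDerivAt.comp_wirtinger (β := fun x' => α (x', t)) (hasFDerivAt_re _)
      cx).const_add z).mul (HasFDerivAt.comp_wirtinger (β := fun x' => α (x', t)) hroot cx)
    refine ((h1.const_mul (2 * σ : ℂ)).congr_deriv ?_).congr_of_eventuallyEq ?_
    -- The coefficient of `α_x` is `R/2 - (z + Re α) R / (2 (z - α))`, which equals `-R V / (2 (z -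
    -- α))` because `(z + Re α) - (z - α) = V`.
    · simp only [hself, V_eq, map_mul, map_add, Complex.conj_ofReal]
      field_simp
      ring
    · have hev := cx.continuousAt.eventually (eventually_mem_inside hA.2.1 hz)
      filter_upwards [eventually_fst_mem hD hp, hev] with x' hx' hx''
      rw [ht_eq hf hσ (hα _ hx') hx'']
      simp only [Pi.mul_apply]
      ring
  · have h1 := HasFDerivAt.comp_wirtinger (β := fun t' => α (x, t')) hroot ct
    refine ((h1.const_mul (2 * σ : ℂ)).congr_deriv ?_).congr_of_eventuallyEq ?_
    · field_simp
      ring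
    · have hev := ct.continuousAt.eventually (eventually_mem_inside hA.2.1 hz)
      filter_upwards [eventually_snd_mem hD hp, hev] with t' ht' ht''
      rw [hx_eq hf hσ (hα _ ht') ht'']

/-- With `X = V α_x - α_t`, the difference of the two mixed derivatives is a nonzero multiple of `X
/ (z - α) + X̄ / (z - ᾱ)`. Its numerator has degree at most one in `z`, so vanishing at two points
forces `X = 0`, using `α ≠ ᾱ`. -/
theorem solvesWhitham_iff_compatible (hf : γ.IsSchwarz f₀) (hσ : σ = 1 ∨ σ = -1)
    {D : Set (ℝ × ℝ)} {α : ℝ × ℝ → ℂ} (hD : IsOpen D) (hd : DifferentiableOn ℝ α D)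
    (hα : ∀ p ∈ D, α p ∈ encircled γ σ) :
    SolvesWhitham D α ↔
      ∀ x t : ℝ, (x, t) ∈ D → ∀ z ∈ inside γ (α (x, t)), ∀ r : ℂ,
        r ^ 2 = radicand (α (x, t)) z → r ≠ 0 →
        ∃ c : ℂ,
          HasDerivAt (fun x' : ℝ =>
            ht γ σ f₀ z (sqrtNear r (radicand (α (x', t)) z)) x' t (α (x', t))) c x ∧
          HasDerivAt (fun t' : ℝ =>
            hx γ σ f₀ z (sqrtNear r (radicand (α (x, t')) z)) x t' (α (x, t'))) c t := by
  rw [solvesWhitham_iff hD hd]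
  refine ⟨fun hW x t hp z hz r hr hr0 => ?_, ?_⟩
  · obtain ⟨h1, h2⟩ := hasDerivAt_ht_hx_along hf hσ hD hd hα hp hz hr hr0
    rw [hW _ hp] at h2
    exact ⟨_, h1, h2⟩
  rintro H ⟨x, t⟩ hp
  have hA := hα _ hp
  have hσ0 : (σ : ℂ) ≠ 0 := fun h0 => by simpa [h0] using sign_sq hσ
  set X := V (α (x, t)) * fderiv ℝ α (x, t) (1, 0) - fderiv ℝ α (x, t) (0, 1) with hX
  have key : ∀ z ∈ inside γ (α (x, t)), (∃ r : ℂ, r ^ 2 = radicand (α (x, t)) z ∧ r ≠ 0) →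
      (X + conj X) * z - (X * conj (α (x, t)) + conj X * α (x, t)) = 0 := by
    rintro z hz ⟨r, hr, hr0⟩
    obtain ⟨n1, n2⟩ := sub_ne_zero_of_sq_eq hr hr0
    obtain ⟨h1, h2⟩ := hasDerivAt_ht_hx_along hf hσ hD hd hα hp hz hr hr0
    obtain ⟨c, h3, h4⟩ := H x t hp z hz r hr hr0
    have h5 := mul_left_cancel₀ (neg_ne_zero.mpr (mul_ne_zero hσ0 hr0))
      ((h1.unique h3).trans (h4.unique h2))
    field_simp at h5
    rw [hX]
    simp only [map_sub]
    linear_combination h5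
  have hin := mem_inside_self hA.2.1
  obtain ⟨z₁, hz₁, -, hr₁⟩ := exists_inside_sq_eq hin ∅
  obtain ⟨z₂, hz₂, hne, hr₂⟩ := exists_inside_sq_eq hin {z₁}
  rw [Finset.mem_singleton, ← sub_eq_zero] at hne
  have k1 := key z₁ hz₁ hr₁
  have k2 := key z₂ hz₂ hr₂
  have k3 : X + conj X = 0 := by
    refine (mul_eq_zero.mp (?_ : (X + conj X) * (z₂ - z₁) = 0)).resolve_right hne
    linear_combination k2 - k1
  have k4 : X * (α (x, t) - conj (α (x, t))) = 0 := by
    linear_combination k1 + (α (x, t) - z₁) * k3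
  have k5 := (mul_eq_zero.mp k4).resolve_right (sub_conj_ne_zero hA.1)
  exact (sub_eq_zero.mp k5).symm

end

/-! ### Differentials on the genus zero surface -/

theorem mem_curve_iff {α z r : ℂ} :
    (z, r) ∈ curve α ↔ r ^ 2 = (z - α.re) ^ 2 + (α.im : ℂ) ^ 2 := by
  rw [curve, mem_ofPred_eq, radicand_eq]

/-- `R(1/ζ) ζ`, the branch with the value `1` at `ζ = 0`. -/
def rootAtInfinity (α ζ : ℂ) : ℂ := ((1 - α.re * ζ) ^ 2 + (α.im : ℂ) ^ 2 * ζ ^ 2) ^ (1 / 2 : ℂ)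

theorem rootAtInfinity_sq (α ζ : ℂ) :
    rootAtInfinity α ζ ^ 2 = (1 - α.re * ζ) ^ 2 + (α.im : ℂ) ^ 2 * ζ ^ 2 := by
  rw [rootAtInfinity, one_div, Complex.cpow_ofNat_inv_pow]

theorem rootAtInfinity_zero (α : ℂ) : rootAtInfinity α 0 = 1 := by
  simp [rootAtInfinity]

theorem analyticAt_rootAtInfinity (α : ℂ) : AnalyticAt ℂ (rootAtInfinity α) 0 := by
  have h1 : AnalyticAt ℂ (fun ζ : ℂ => (1 - α.re * ζ) ^ 2 + (α.im : ℂ) ^ 2 * ζ ^ 2) 0 := by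
    fun_prop
  exact h1.cpow (g := fun _ => (1 / 2 : ℂ)) analyticAt_const (by simp)

/-- With `S = rootAtInfinity α ζ` and `L = 1 - ζ Re α`, `S² - L² = (Im α)² ζ²`. Hence `(S - L) / (S
ζ²)` is `(Im α)²` times this function, which shows that the remainder has no pole. -/
theorem analyticAt_principalPart_remainder (α : ℂ) :
    AnalyticAt ℂ (fun ζ => 1 / (rootAtInfinity α ζ * (rootAtInfinity α ζ + (1 - α.re * ζ)))) 0 := by
  have hS := analyticAt_rootAtInfinity α
  have hl : AnalyticAt ℂ (fun ζ : ℂ => 1 - α.re * ζ) 0 := by fun_prop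
  refine analyticAt_const.fun_div (hS.mul (hS.add hl)) ?_
  norm_num [rootAtInfinity_zero]

/-- The bound `‖r * ζ - ε‖ < 1` selects the sheet: on the other one `‖S + 1‖ < 1`, while `‖S - 1‖ <
1` near `ζ = 0`, and these distances must add up to at least `2`. -/
theorem eventually_root_ne_zero (α : ℂ) : ∀ᶠ ζ in 𝓝[≠] (0 : ℂ), ζ ≠ 0 ∧ rootAtInfinity α ζ ≠ 0 ∧
    rootAtInfinity α ζ + (1 - α.re * ζ) ≠ 0 ∧
    ∀ ε : ℂ, ε = 1 ∨ ε = -1 → ∀ r : ℂ, (ζ⁻¹, r) ∈ curve α → ‖r * ζ - ε‖ < 1 →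
      r = ε * rootAtInfinity α ζ / ζ := by
  have hS := (analyticAt_rootAtInfinity α).continuousAt
  have hl : ContinuousAt (fun ζ : ℂ => 1 - α.re * ζ) 0 := by fun_prop
  have e1 : ∀ᶠ ζ in 𝓝 (0 : ℂ), rootAtInfinity α ζ ≠ 0 :=
    hS.eventually_ne (by simp [rootAtInfinity_zero])
  have e2 : ∀ᶠ ζ in 𝓝 (0 : ℂ), rootAtInfinity α ζ + (1 - α.re * ζ) ≠ 0 :=
    (hS.add hl).eventually_ne (by norm_num [rootAtInfinity_zero])
  have e3 : ∀ᶠ ζ in 𝓝 (0 : ℂ), ‖rootAtInfinity α ζ - 1‖ < 1 := by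
    have : ContinuousAt (fun ζ => ‖rootAtInfinity α ζ - 1‖) 0 := (hS.sub continuousAt_const).norm
    refine this.eventually_lt continuousAt_const ?_
    simp [rootAtInfinity_zero]
  filter_upwards [nhdsWithin_le_nhds e1, nhdsWithin_le_nhds e2, nhdsWithin_le_nhds e3,
    self_mem_nhdsWithin] with ζ h1 h2 h3 h0
  have h0' : ζ ≠ 0 := h0
  refine ⟨h0', h1, h2, fun ε hε r hr hn => ?_⟩
  rw [mem_curve_iff] at hr
  have hε2 : ε ^ 2 = 1 := by rcases hε with rfl | rfl <;> norm_num
  have hsq : (r * ζ) ^ 2 = (ε * rootAtInfinity α ζ) ^ 2 := by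
    rw [mul_pow, mul_pow, hε2, rootAtInfinity_sq, hr]
    field_simp
  rcases sq_eq_sq_iff_eq_or_eq_neg.mp hsq with h | h
  · rw [eq_div_iff h0', h]
  · exfalso
    rw [h] at hn
    have hεn : ‖ε‖ = 1 := by rcases hε with rfl | rfl <;> simp
    have h4 : ‖rootAtInfinity α ζ + 1‖ < 1 := by
      rw [show -(ε * rootAtInfinity α ζ) - ε = -ε * (rootAtInfinity α ζ + 1) by ring, norm_mul,
        norm_neg, hεn, one_mul] at hn
      exact hn
    have h5 := norm_sub_le (rootAtInfinity α ζ + 1) (rootAtInfinity α ζ - 1)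
    rw [show rootAtInfinity α ζ + 1 - (rootAtInfinity α ζ - 1) = 2 by ring] at h5
    norm_num at h5
    linarith

/-- The differential `dR = (z - Re α) dz / R` is the quasimomentum differential. -/
theorem isQuasimomentum_sub_re (α : ℂ) : IsQuasimomentum α (fun P => P.1 - α.re) := by
  refine ⟨fun P _ => ⟨_, analyticAt_fst.sub analyticAt_const, EventuallyEq.rfl⟩, fun ε hε =>
    ⟨_, (analyticAt_const (v := (α.im : ℂ) ^ 2)).mul (analyticAt_principalPart_remainder α), ?_⟩⟩
  filter_upwards [eventually_root_ne_zero α] with ζ ⟨h0, h1, h2, hroot⟩ r hr hn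
  have hε2 : ε ^ 2 = 1 := by rcases hε with rfl | rfl <;> norm_num
  have hε0 : ε ≠ 0 := by rintro rfl; norm_num at hε2
  have hS := rootAtInfinity_sq α ζ
  rw [hroot ε hε r hr hn]
  simp only [Pi.mul_apply]
  set S := rootAtInfinity α ζ
  obtain ⟨T, hT⟩ : ∃ T, T = S + (1 - α.re * ζ) := ⟨_, rfl⟩
  rw [← hT] at h2 ⊢
  have hb : (α.im : ℂ) ^ 2 * ζ ^ 2 = T * (S - (1 - α.re * ζ)) := by
    rw [hT]; linear_combination -hS
  field_simp
  rw [hε2, ← sub_eq_zero]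
  linear_combination -hb

/-- The differential `d((z + Re α) R)` is the quasienergy differential. -/
theorem isQuasienergy_quadratic (α : ℂ) :
    IsQuasienergy α (fun P => 2 * P.1 ^ 2 - 2 * α.re * P.1 + (α.im : ℂ) ^ 2) := by
  have hK := analyticAt_principalPart_remainder α
  have hS := analyticAt_rootAtInfinity α
  have hl : AnalyticAt ℂ (fun ζ : ℂ => 1 - α.re * ζ) 0 := by fun_prop
  have hinv : AnalyticAt ℂ (fun ζ : ℂ => ζ / (rootAtInfinity α ζ + (1 - α.re * ζ))) 0 :=
    analyticAt_id.fun_div (hS.add hl) (by norm_num [rootAtInfinity_zero])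
  refine ⟨fun P _ => ⟨_, ?_, EventuallyEq.rfl⟩, fun ε hε =>
    ⟨fun ζ => (α.im : ℂ) ^ 2 * (2 * α.re - (α.im : ℂ) ^ 2 *
      (ζ / (rootAtInfinity α ζ + (1 - α.re * ζ)))) *
      (1 / (rootAtInfinity α ζ * (rootAtInfinity α ζ + (1 - α.re * ζ)))),
      (analyticAt_const.mul (analyticAt_const.sub (analyticAt_const.mul hinv))).mul hK, ?_⟩⟩
  · exact ((analyticAt_const.mul (analyticAt_fst.pow 2)).sub
      (analyticAt_const.mul analyticAt_fst)).add analyticAt_const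
  filter_upwards [eventually_root_ne_zero α] with ζ ⟨h0, h1, h2, hroot⟩ r hr hn
  have hε2 : ε ^ 2 = 1 := by rcases hε with rfl | rfl <;> norm_num
  have hε0 : ε ≠ 0 := by rintro rfl; norm_num at hε2
  have hSq := rootAtInfinity_sq α ζ
  rw [hroot ε hε r hr hn]
  set S := rootAtInfinity α ζ
  have hb : (α.im : ℂ) ^ 2 * ζ ^ 2 = (S + (1 - α.re * ζ)) * (S - (1 - α.re * ζ)) := by
    linear_combination -hSq
  have hk : (α.im : ℂ) ^ 2 * ζ * (ζ / (S + (1 - α.re * ζ))) = S - (1 - α.re * ζ) := by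
    rw [← mul_div_assoc, div_eq_iff h2]
    linear_combination hb
  have hm : (α.im : ℂ) ^ 2 * ζ ^ 2 / (S + (1 - α.re * ζ)) = S - (1 - α.re * ζ) := by
    rw [hb]; field_simp
  -- With `S` and `L = 1 - ζ Re α`, the numerator `2S - 2L - (Im α)² ζ²` factors as `(S - L)(2 - S -
  -- L)`. The factors supply `ζ²` and `ζ`, cancelling the cubic pole.
  have hH : ((α.im : ℂ) ^ 2 * (2 * α.re - (α.im : ℂ) ^ 2 * (ζ / (S + (1 - α.re * ζ)))) *
      (1 / (S * (S + (1 - α.re * ζ))))) =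
      (2 * S - (2 - 2 * α.re * ζ + (α.im : ℂ) ^ 2 * ζ ^ 2)) / (S * ζ ^ 3) := by
    have e1 : ((α.im : ℂ) ^ 2 * (2 * α.re - (α.im : ℂ) ^ 2 * (ζ / (S + (1 - α.re * ζ)))) *
        (1 / (S * (S + (1 - α.re * ζ))))) =
        ((α.im : ℂ) ^ 2 * ζ ^ 2 / (S + (1 - α.re * ζ))) *
          (2 * α.re * ζ - (α.im : ℂ) ^ 2 * ζ * (ζ / (S + (1 - α.re * ζ)))) / (S * ζ ^ 3) := by
      field_simp
    rw [e1, hk, hm]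
    congr 1
    linear_combination -hSq
  rw [hH]
  field_simp
  rw [hε2]
  ring

/-- The rational parametrization of the surface. -/
def rationalPoint (α ε v : ℂ) : ℂ × ℂ :=
  ((1 + 2 * α.re * v - (α.im : ℂ) ^ 2 * v ^ 2) / (2 * v),
    ε * (1 + (α.im : ℂ) ^ 2 * v ^ 2) / (2 * v))

theorem rationalPoint_mem_curve (α : ℂ) {ε v : ℂ} (hε : ε ^ 2 = 1) (hv : v ≠ 0) :
    rationalPoint α ε v ∈ curve α := by
  rw [rationalPoint, mem_curve_iff]
  field_simp
  rw [hε]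
  ring

/-- On the conic `(r + (z - Re α)) (r - (z - Re α)) = (Im α)²`, the first factor is nonzero and
determines the point; its inverse is the parameter `v`. -/
theorem exists_rationalPoint {α z r : ℂ} (hα : α.im ≠ 0) (h : (z, r) ∈ curve α) :
    ∃ v ≠ 0, rationalPoint α 1 v = (z, r) := by
  rw [mem_curve_iff] at h
  have hb : (α.im : ℂ) ≠ 0 := by exact_mod_cast hα
  have hprod : (z - α.re + r) * (r - (z - α.re)) = (α.im : ℂ) ^ 2 := by linear_combination h
  have hu : z - α.re + r ≠ 0 := by
    intro h0
    rw [h0, zero_mul] at hprod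
    exact pow_ne_zero 2 hb hprod.symm
  refine ⟨(z - α.re + r)⁻¹, inv_ne_zero hu, ?_⟩
  rw [rationalPoint, Prod.mk.injEq, ← hprod]
  constructor
  · field_simp
    ring
  · field_simp
    ring

/-- This change of parameter exchanges the two points at infinity, so `v → ∞` in one chart is `v →
0` in the chart at the other point. -/
theorem rationalPoint_one {α v : ℂ} (hα : α.im ≠ 0) (hv : v ≠ 0) :
    rationalPoint α 1 v = rationalPoint α (-1) (-((α.im : ℂ) ^ 2 * v)⁻¹) := by
  have hb : (α.im : ℂ) ≠ 0 := by exact_mod_cast hα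
  simp only [rationalPoint, Prod.mk.injEq]
  constructor
  · field_simp
    ring
  · field_simp
    ring

theorem differentiableAt_comp_rationalPoint {α : ℂ} {F : ℂ × ℂ → ℂ} (hF : HolomorphicOnCurve α F)
    {v : ℂ} (hv : v ≠ 0) : DifferentiableAt ℂ (fun v => F (rationalPoint α 1 v)) v := by
  obtain ⟨G, hG, hFG⟩ := hF _ (rationalPoint_mem_curve α (one_pow 2) hv)
  have h2 : (2 : ℂ) * v ≠ 0 := mul_ne_zero two_ne_zero hv
  have hQ : DifferentiableAt ℂ (rationalPoint α 1) v := by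
    unfold rationalPoint
    refine DifferentiableAt.prodMk (DifferentiableAt.fun_div (by fun_prop) (by fun_prop) h2)
      (DifferentiableAt.fun_div (by fun_prop) (by fun_prop) h2)
  refine (hG.differentiableAt.comp v hQ).congr_of_eventuallyEq ?_
  have ht : Tendsto (rationalPoint α 1) (𝓝 v) (𝓝[curve α] (rationalPoint α 1 v)) := by
    refine tendsto_nhdsWithin_iff.mpr ⟨hQ.continuousAt, ?_⟩
    filter_upwards [isOpen_ne.mem_nhds hv] with y hy
    exact rationalPoint_mem_curve α (one_pow 2) hy
  exact ht.eventually hFG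

/-- Equal principal parts leave `F₁ - F₂ = -r ζ² ε (H₁ - H₂)`; here `r ζ → ε` and `ζ → 0`, so the
difference vanishes at the point at infinity. -/
theorem tendsto_sub_at_infinity {α : ℂ} {F₁ F₂ : ℂ × ℂ → ℂ} {k : ℂ → ℂ}
    (h₁ : PrincipalPartAtInfinity α F₁ k) (h₂ : PrincipalPartAtInfinity α F₂ k) {ε : ℂ}
    (hε : ε = 1 ∨ ε = -1) :
    Tendsto (fun v => F₁ (rationalPoint α ε v) - F₂ (rationalPoint α ε v)) (𝓝[≠] 0) (𝓝 0) := by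
  obtain ⟨H₁, hH₁, e₁⟩ := h₁ ε hε
  obtain ⟨H₂, hH₂, e₂⟩ := h₂ ε hε
  have hε2 : ε ^ 2 = 1 := by rcases hε with rfl | rfl <;> norm_num
  set den : ℂ → ℂ := fun v => 1 + 2 * α.re * v - (α.im : ℂ) ^ 2 * v ^ 2 with hden
  set ζ : ℂ → ℂ := fun v => 2 * v / den v with hζ
  set q : ℂ → ℂ := fun v => ε * (1 + (α.im : ℂ) ^ 2 * v ^ 2) / den v with hq
  have hdc : ContinuousAt den 0 := by
    rw [hden]; fun_prop
  have hd0 : den 0 ≠ 0 := by simp [hden]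
  have hζc : ContinuousAt ζ 0 := ContinuousAt.div (by fun_prop) hdc hd0
  have hqc : ContinuousAt q 0 := ContinuousAt.div (by fun_prop) hdc hd0
  have hζ0 : ζ 0 = 0 := by simp [hζ]
  have hq0 : q 0 = ε := by simp [hq, hden]
  have hne : ∀ᶠ v in 𝓝[≠] (0 : ℂ), den v ≠ 0 ∧ v ≠ 0 :=
    ((hdc.eventually_ne hd0).filter_mono nhdsWithin_le_nhds).and self_mem_nhdsWithin
  have ht : Tendsto ζ (𝓝[≠] 0) (𝓝[≠] 0) := by
    refine tendsto_nhdsWithin_iff.mpr ⟨?_, ?_⟩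
    · have := hζc.tendsto
      rw [hζ0] at this
      exact this.mono_left nhdsWithin_le_nhds
    · filter_upwards [hne] with v hv
      exact div_ne_zero (mul_ne_zero two_ne_zero hv.2) hv.1
  have hclose : ∀ᶠ v in 𝓝[≠] (0 : ℂ), ‖q v - ε‖ < 1 := by
    refine nhdsWithin_le_nhds ?_
    have : ContinuousAt (fun v => ‖q v - ε‖) 0 := (hqc.sub continuousAt_const).norm
    refine this.eventually_lt continuousAt_const ?_
    simp [hq0]
  have hlim : Tendsto (fun v => -(q v * ζ v * ε * (H₁ (ζ v) - H₂ (ζ v)))) (𝓝[≠] 0) (𝓝 0) := by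
    have hc : ContinuousAt (fun v => -(q v * ζ v * ε * (H₁ (ζ v) - H₂ (ζ v)))) 0 := by
      have c₁ : ContinuousAt (fun v => H₁ (ζ v)) 0 :=
        ContinuousAt.comp (f := ζ) (by rw [hζ0]; exact hH₁.continuousAt) hζc
      have c₂ : ContinuousAt (fun v => H₂ (ζ v)) 0 :=
        ContinuousAt.comp (f := ζ) (by rw [hζ0]; exact hH₂.continuousAt) hζc
      exact (((hqc.mul hζc).mul continuousAt_const).mul (c₁.sub c₂)).neg
    have := hc.tendsto
    simp only [hζ0, mul_zero, zero_mul, neg_zero] at this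
    exact this.mono_left nhdsWithin_le_nhds
  refine hlim.congr' ?_
  filter_upwards [hne, hclose, ht.eventually e₁, ht.eventually e₂] with v ⟨hv1, hv0⟩ hcl E₁ E₂
  have hζv : ζ v ≠ 0 := div_ne_zero (mul_ne_zero two_ne_zero hv0) hv1
  have hfst : (rationalPoint α ε v).1 = (ζ v)⁻¹ := by
    simp only [rationalPoint, hζ, hden, inv_div]
  have hsnd : (rationalPoint α ε v).2 * ζ v = q v := by
    simp only [rationalPoint, hζ, hq]
    field_simp
  have hmem := rationalPoint_mem_curve α hε2 hv0
  set r := (rationalPoint α ε v).2 with hr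
  have hP : rationalPoint α ε v = ((ζ v)⁻¹, r) := Prod.ext hfst rfl
  rw [hP] at hmem ⊢
  have hq1 : q v ≠ 0 := by
    intro h0
    rw [h0, zero_sub, norm_neg] at hcl
    rcases hε with rfl | rfl <;> simp at hcl
  have hr0 : r ≠ 0 := by
    intro h0
    rw [h0, zero_mul] at hsnd
    exact hq1 hsnd.symm
  have f₁ := E₁ r hmem (by rw [hsnd]; exact hcl)
  have f₂ := E₂ r hmem (by rw [hsnd]; exact hcl)
  rw [← hsnd]
  have f₃ : (F₁ ((ζ v)⁻¹, r) - F₂ ((ζ v)⁻¹, r)) / r * (-1 / ζ v ^ 2) =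
      ε * (H₁ (ζ v) - H₂ (ζ v)) := by
    rw [sub_div, sub_mul, f₁, f₂]; ring
  rw [show r * ζ v * ζ v * ε * (H₁ (ζ v) - H₂ (ζ v)) =
    r * ζ v * ζ v * (ε * (H₁ (ζ v) - H₂ (ζ v))) by ring, ← f₃]
  field_simp

/-- A differential on the surface is determined by its principal parts at infinity. -/
theorem eqOn_curve_of_principalPart {α : ℂ} (hα : α.im ≠ 0) {F₁ F₂ : ℂ × ℂ → ℂ} {k : ℂ → ℂ}
    (hol₁ : HolomorphicOnCurve α F₁) (hol₂ : HolomorphicOnCurve α F₂)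
    (h₁ : PrincipalPartAtInfinity α F₁ k) (h₂ : PrincipalPartAtInfinity α F₂ k) :
    EqOn F₁ F₂ (curve α) := by
  rintro ⟨z, r⟩ hzr
  obtain ⟨v, hv, hvP⟩ := exists_rationalPoint hα hzr
  have hb : (α.im : ℂ) ≠ 0 := by exact_mod_cast hα
  -- The difference pulled back to the `v`-plane, with its limit `0` at `∞⁺` as value at `v = 0`;
  -- the singularity is removable.
  set Φ : ℂ → ℂ := Function.update
    (fun v => F₁ (rationalPoint α 1 v) - F₂ (rationalPoint α 1 v)) 0 0 with hΦ
  have hΦv : ∀ y, y ≠ 0 → Φ y = F₁ (rationalPoint α 1 y) - F₂ (rationalPoint α 1 y) :=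
    fun y hy => Function.update_of_ne hy _ _
  have hcont : ContinuousAt Φ 0 :=
    continuousAt_update_same.mpr (tendsto_sub_at_infinity h₁ h₂ (Or.inl rfl))
  have hdiff : DifferentiableOn ℂ Φ (univ \ {0}) := by
    intro y hy
    have hy0 : y ≠ 0 := hy.2
    refine DifferentiableAt.differentiableWithinAt ?_
    refine ((differentiableAt_comp_rationalPoint hol₁ hy0).sub
      (differentiableAt_comp_rationalPoint hol₂ hy0)).congr_of_eventuallyEq ?_
    filter_upwards [isOpen_ne.mem_nhds hy0] with y' hy'
    exact hΦv y' hy'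
  have hentire : Differentiable ℂ Φ := differentiableOn_univ.mp
    ((Complex.differentiableOn_compl_singleton_and_continuousAt_iff univ_mem).mp ⟨hdiff, hcont⟩)
  -- As `v → ∞` the point tends to `∞⁻`, so `Φ` tends to `0` there and Liouville's theorem applies.
  have hinf : Tendsto (fun v : ℂ => -((α.im : ℂ) ^ 2 * v)⁻¹) (cocompact ℂ) (𝓝[≠] 0) := by
    refine tendsto_nhdsWithin_iff.mpr ⟨?_, ?_⟩
    · rw [← Metric.cobounded_eq_cocompact]
      have := (tendsto_inv₀_cobounded (α := ℂ)).const_mul (-((α.im : ℂ) ^ 2)⁻¹)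
      rw [mul_zero] at this
      refine this.congr fun v => ?_
      rw [mul_inv]; ring
    · filter_upwards [(Set.finite_singleton (0 : ℂ)).isCompact.compl_mem_cocompact] with v hv
      exact neg_ne_zero.mpr (inv_ne_zero (mul_ne_zero (pow_ne_zero 2 hb) hv))
  have hlim : Tendsto Φ (cocompact ℂ) (𝓝 0) := by
    refine ((tendsto_sub_at_infinity h₁ h₂ (Or.inr rfl)).comp hinf).congr' ?_
    filter_upwards [(Set.finite_singleton (0 : ℂ)).isCompact.compl_mem_cocompact] with y hy
    rw [hΦv y hy, rationalPoint_one hα hy]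
    rfl
  have hzero := hentire.apply_eq_of_tendsto_cocompact v hlim
  rw [hΦv v hv, hvP] at hzero
  exact sub_eq_zero.mp hzero

/-! ### Explicit form and primitives of the quasimomentum and the quasienergy -/

theorem IsQuasimomentum.eq {α : ℂ} (hα : α.im ≠ 0) {dp : ℂ × ℂ → ℂ} (h : IsQuasimomentum α dp)
    {z r : ℂ} (hzr : (z, r) ∈ curve α) : dp (z, r) = z - α.re :=
  have h' := isQuasimomentum_sub_re α
  eqOn_curve_of_principalPart hα h.1 h'.1 h.2 h'.2 hzr

theorem IsQuasienergy.eq {α : ℂ} (hα : α.im ≠ 0) {dq : ℂ × ℂ → ℂ} (h : IsQuasienergy α dq)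
    {z r : ℂ} (hzr : (z, r) ∈ curve α) :
    dq (z, r) = 2 * z ^ 2 - 2 * α.re * z + (α.im : ℂ) ^ 2 :=
  have h' := isQuasienergy_quadratic α
  eqOn_curve_of_principalPart hα h.1 h'.1 h.2 h'.2 hzr

theorem IsQuasimomentum.hasDerivAt {α : ℂ} (hα : α.im ≠ 0) {dp : ℂ × ℂ → ℂ}
    (h : IsQuasimomentum α dp) {z r : ℂ} (hzr : (z, r) ∈ curve α) (hr0 : r ≠ 0) :
    HasDerivAt (fun z' => sqrtNear r (radicand α z')) (dp (z, r) / r) z := by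
  rw [h.eq hα hzr]
  exact hasDerivAt_sqrtNear_radicand hzr hr0

theorem IsQuasienergy.hasDerivAt {α : ℂ} (hα : α.im ≠ 0) {dq : ℂ × ℂ → ℂ}
    (h : IsQuasienergy α dq) {z r : ℂ} (hzr : (z, r) ∈ curve α) (hr0 : r ≠ 0) :
    HasDerivAt (fun z' => (z' + (α.re : ℂ)) * sqrtNear r (radicand α z')) (dq (z, r) / r) z := by
  rw [h.eq hα hzr]
  have hr : r ^ 2 = radicand α z := hzr
  refine (((hasDerivAt_id z).add_const (α.re : ℂ)).mul
    (hasDerivAt_sqrtNear_radicand hr hr0)).congr_deriv ?_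
  have hself : sqrtNear r (radicand α z) = r := by rw [← hr, sqrtNear_self hr0]
  rw [radicand_eq] at hr
  simp only [hself, id]
  field_simp
  linear_combination hr

end GenusZero

end

theorem mainTheorem7 (γ : SymmetricLoop) (σ : ℤ) (hσ : σ = 1 ∨ σ = -1) (f₀ : ℂ → ℂ)
    (hsymm : ∀ z : ℂ, z.im ≠ 0 → f₀ (conj z) = conj (f₀ z))
    (hcont : ContinuousOn (fun s => f₀ (γ.path s)) (Icc 0 1)) :
    -- the modulation equation is the hodograph equation with velocity `V` and with `w`
    (∀ α ∈ encircled γ σ, ∀ x t : ℝ,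
      (ModulationEq γ σ f₀ x t α ↔ (x : ℂ) + V α * t = w γ σ f₀ α) ∧
      (ModulationEqConj γ σ f₀ x t α ↔ (x : ℂ) + conj (V α) * t = conj (w γ σ f₀ α)) ∧
      (ModulationEq γ σ f₀ x t α ↔ ModulationEqConj γ σ f₀ x t α)) ∧
    -- `w` satisfies the Tsarev equation
    (∀ α ∈ encircled γ σ, IsTsarevAt V (w γ σ f₀) α) ∧
    -- solutions of the modulation equation solve the Whitham system
    (∀ (D : Set (ℝ × ℝ)) (α : ℝ × ℝ → ℂ), IsOpen D → DifferentiableOn ℝ α D →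
      (∀ p ∈ D, α p ∈ encircled γ σ ∧ ModulationEq γ σ f₀ p.1 p.2 (α p)) →
      SolvesWhitham D α) ∧
    -- the derivatives of `h` in `α` and `ᾱ`
    (∀ α ∈ encircled γ σ, ∀ x t : ℝ,
      (∀ z ∈ inside γ α, ∀ r : ℂ, r ^ 2 = radicand α z → r ≠ 0 →
        DifferentiableAt ℝ (fun a => h γ σ f₀ z (sqrtNear r (radicand a z)) x t a) α ∧
        wirtinger (fun a => h γ σ f₀ z (sqrtNear r (radicand a z)) x t a) α =
          -(r / (2 * (z - α))) *
            (1 / (2 * Real.pi * Complex.I) * cauchy γ σ α (phase f₀ x t) α) ∧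
        wirtingerBar (fun a => h γ σ f₀ z (sqrtNear r (radicand a z)) x t a) α =
          -(r / (2 * (z - conj α))) *
            (1 / (2 * Real.pi * Complex.I) * cauchy γ σ α (phase f₀ x t) (conj α))) ∧
      ((∀ z ∈ inside γ α, ∀ r : ℂ, r ^ 2 = radicand α z → r ≠ 0 →
        wirtinger (fun a => h γ σ f₀ z (sqrtNear r (radicand a z)) x t a) α = 0) ↔
          ModulationEq γ σ f₀ x t α) ∧
      ((∀ z ∈ inside γ α, ∀ r : ℂ, r ^ 2 = radicand α z → r ≠ 0 →
        wirtingerBar (fun a => h γ σ f₀ z (sqrtNear r (radicand a z)) x t a) α = 0) ↔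
          ModulationEqConj γ σ f₀ x t α)) ∧
    -- the partial derivatives `h_x`, `h_t`, and the decomposition of `h`
    (∀ α ∈ encircled γ σ, ∀ x t : ℝ, ∀ z ∈ inside γ α, ∀ r : ℂ, r ^ 2 = radicand α z →
      HasDerivAt (fun x' : ℝ => h γ σ f₀ z r x' t α) (2 * (σ : ℂ) * r) x ∧
      HasDerivAt (fun t' : ℝ => h γ σ f₀ z r x t' α) (2 * (σ : ℂ) * (z + (α.re : ℂ)) * r) t ∧
      h γ σ f₀ z r x t α =
        x * hx γ σ f₀ z r x t α + t * ht γ σ f₀ z r x t α + h₀ γ σ f₀ z r α) ∧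
    -- on solutions of the modulation equation the full derivatives of `h` are `h_x` and `h_t`
    (∀ (D : Set (ℝ × ℝ)) (α : ℝ × ℝ → ℂ), IsOpen D → DifferentiableOn ℝ α D →
      (∀ p ∈ D, α p ∈ encircled γ σ ∧ ModulationEq γ σ f₀ p.1 p.2 (α p)) →
      ∀ x t : ℝ, (x, t) ∈ D → ∀ z ∈ inside γ (α (x, t)), ∀ r : ℂ,
        r ^ 2 = radicand (α (x, t)) z → r ≠ 0 →
        HasDerivAt (fun x' : ℝ => h γ σ f₀ z (sqrtNear r (radicand (α (x', t)) z)) x' t (α (x', t)))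
          (2 * (σ : ℂ) * r) x ∧
        HasDerivAt (fun t' : ℝ => h γ σ f₀ z (sqrtNear r (radicand (α (x, t')) z)) x t' (α (x, t')))
          (2 * (σ : ℂ) * (z + ((α (x, t)).re : ℂ)) * r) t) ∧
    -- `∂_x h_t = ∂_t h_x` is equivalent to the Whitham system
    (∀ (D : Set (ℝ × ℝ)) (α : ℝ × ℝ → ℂ), IsOpen D → DifferentiableOn ℝ α D →
      (∀ p ∈ D, α p ∈ encircled γ σ) →
      (SolvesWhitham D α ↔
        ∀ x t : ℝ, (x, t) ∈ D → ∀ z ∈ inside γ (α (x, t)), ∀ r : ℂ,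
          r ^ 2 = radicand (α (x, t)) z → r ≠ 0 →
          ∃ c : ℂ,
            HasDerivAt (fun x' : ℝ =>
              ht γ σ f₀ z (sqrtNear r (radicand (α (x', t)) z)) x' t (α (x', t))) c x ∧
            HasDerivAt (fun t' : ℝ =>
              hx γ σ f₀ z (sqrtNear r (radicand (α (x, t')) z)) x t' (α (x, t'))) c t)) ∧
    -- `dh_x = 2σ dp`, and `σ h_x / 2` extends to a primitive `r` of `dp` on the Riemann surface
    (∀ α ∈ encircled γ σ,
      (∃ dp : ℂ × ℂ → ℂ, IsQuasimomentum α dp) ∧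
      ∀ dp : ℂ × ℂ → ℂ, IsQuasimomentum α dp → ∀ z r : ℂ, (z, r) ∈ curve α → r ≠ 0 →
        HasDerivAt (fun z' => sqrtNear r (radicand α z')) (dp (z, r) / r) z ∧
        (z ∈ inside γ α → ∀ x t : ℝ,
          HasDerivAt (fun z' => hx γ σ f₀ z' (sqrtNear r (radicand α z')) x t α)
            (2 * (σ : ℂ) * (dp (z, r) / r)) z)) ∧
    -- `dh_t = 2σ dq`, and `σ h_t / 2` extends to a primitive `(z + Re α) r` of `dq`
    (∀ α ∈ encircled γ σ,
      (∃ dq : ℂ × ℂ → ℂ, IsQuasienergy α dq) ∧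
      ∀ dq : ℂ × ℂ → ℂ, IsQuasienergy α dq → ∀ z r : ℂ, (z, r) ∈ curve α → r ≠ 0 →
        HasDerivAt (fun z' => (z' + (α.re : ℂ)) * sqrtNear r (radicand α z')) (dq (z, r) / r) z ∧
        (z ∈ inside γ α → ∀ x t : ℝ,
          HasDerivAt (fun z' => ht γ σ f₀ z' (sqrtNear r (radicand α z')) x t α)
            (2 * (σ : ℂ) * (dq (z, r) / r)) z)) := by
  have hf : γ.IsSchwarz f₀ := ⟨hsymm, hcont⟩
  refine ⟨fun α hα x t => ⟨modulationEq_iff hf hσ hα x t, modulationEqConj_iff hf hσ hα x t,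
      modulationEq_iff_conj hf x t α⟩, fun α hα => ?_,
    fun D α hD hd hα => solvesWhitham_of_modulationEq hf hσ hD hd hα,
    fun α hα x t => ⟨fun z hz r hr hr0 => ?_, wirtinger_h_eq_zero_iff hf hσ hα.2.1 x t,
      wirtingerBar_h_eq_zero_iff hf hσ hα.2.1 x t⟩,
    fun α hα x t z hz r _ => ⟨hasDerivAt_h_x hf hσ hα hz r x t, hasDerivAt_h_t hf hσ hα hz r x t,
      ?_⟩,
    fun D α hD hd hα x t hp z hz r hr hr0 => hasDerivAt_h_along hf hσ hD hd hα hp hz hr hr0,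
    fun D α hD hd hα => solvesWhitham_iff_compatible hf hσ hD hd hα,
    fun α hα => ⟨⟨_, isQuasimomentum_sub_re α⟩, fun dp hdp z r hzr hr0 =>
      ⟨hdp.hasDerivAt hα.1 hzr hr0, fun hz x t => ?_⟩⟩,
    fun α hα => ⟨⟨_, isQuasienergy_quadratic α⟩, fun dq hdq z r hzr hr0 =>
      ⟨hdq.hasDerivAt hα.1 hzr hr0, fun hz x t => ?_⟩⟩⟩
  · obtain ⟨w₁, hw⟩ := hasFDerivAt_w hf hσ hα.1 hα.2.1
    exact isTsarevAt_of_hasFDerivAt hα.1 hw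
  · have hd := hasFDerivAt_h hf hσ hα.2.1 (inside_subset hz) hr hr0 x t
    exact ⟨hd.differentiableAt, wirtinger_eq hd, wirtingerBar_eq hd⟩
  · rw [hx_eq hf hσ hα hz, ht_eq hf hσ hα hz, h_eq hf hσ hα hz]
  · refine ((hdp.hasDerivAt hα.1 hzr hr0).const_mul (2 * σ : ℂ)).congr_of_eventuallyEq ?_
    -- The formula for `h_x` is available only inside the loop, which is open, so it holds near `z`.
    filter_upwards [(isOpen_inside γ α).mem_nhds hz] with z' hz'
    rw [hx_eq hf hσ hα hz']
  · refine ((hdq.hasDerivAt hα.1 hzr hr0).const_mul (2 * σ : ℂ)).congr_of_eventuallyEq ?_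
    filter_upwards [(isOpen_inside γ α).mem_nhds hz] with z' hz'
    rw [ht_eq hf hσ hα hz']
    ring
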